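/- For an integer $N\ge 1$ and $p\in[0,1]$ let $G(N,p)$ be the binomial random graph on $N$ labelled vertices (each pair of vertices is an edge independently with probability $p$), let $P_{k}$ be the path on $k$ vertices, and for graphs $G,F$ let $\mathrm{ex}(G,F)$ be the maximum number of edges in a subgraph of $G$ that contains no copy of $F$. All logarithms are natural. Let $N=N(n)$ be integers with $3n\le N\le n e^{2n}$ for all sufficiently large $n$, and let $p=p(n)\in[0,1]$. (i) If $p\ge \frac{\log(N/n)}{6n}$ for all sufficiently large $n$, then $$\Pr\Big[\tfrac14\,pnN\le \mathrm{ex}(G(N,p),P_{n+1})\le 18\,pnN\Big]\to 1\quad\text{as } n\to\infty.$$ (ii) Let $\omega=\omega(n)=\frac{\log(N/n)}{np}$. If $\frac1N\le p\le \frac{\log(N/n)}{6n}$ for all sufficiently large $n$, then $$\Pr\Big[\tfrac1{75}\,\tfrac{\omega}{\log\omega}\,pnN\le \mathrm{ex}(G(N,p),P_{n+1})\le 8\,\tfrac{\omega}{\log\omega}\,pnN\Big]\to 1\quad\text{as } n\to\infty.$$ -/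

import Mathlib

open Filter Topology

namespace SimpleGraph

open scoped Classical in
/-- The relative extremal number `ex(G, F)` of a finite graph `G`: the maximum number of edges of
an `F`-free subgraph of `G`. The subgraphs may be taken spanning: adding isolated vertices changes
neither the number of edges nor `F`-freeness, for `F` connected with at least two vertices. -/
noncomputable def exIn {V W : Type*} [Fintype V] (G : SimpleGraph V) (F : SimpleGraph W) : ℕ :=
  Finset.sup {H : SimpleGraph V | H ≤ G ∧ F.Free H} fun H ↦ H.edgeFinset.card

/-- The probability that the binomial random graph `G(N, p)` satisfies
`a ≤ ex(G(N, p), P_k) ≤ b`, where `P_k` is the path on `k` vertices. -/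
noncomputable def probExPath (N : ℕ) (p : unitInterval) (k : ℕ) (a b : ℝ) : ℝ :=
  (binomialRandom (Fin N) p).real
    {G | a ≤ (G.exIn (pathGraph k) : ℝ) ∧ (G.exIn (pathGraph k) : ℝ) ≤ b}

end SimpleGraph

/-!
Upper bounds: run depth-first search on a `P_{n+1}`-free subgraph. Its stack is a path, so it has
at most `n` vertices, and an edge joining a block of `n` consecutively discovered vertices to
itself or to an earlier vertex stays inside the union of the block with the stack at its start.
Hence `ex(G, P_{n+1})` is at most `N / n + 1` times the largest number of edges of `G` spanned by
`2n` vertices, which a union bound controls.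

Lower bounds: a graph whose components have at most `n` vertices is `P_{n+1}`-free. In the dense
range, take the edges inside disjoint blocks of `n` vertices. In the sparse range the target is,
up to a constant, `N log (N / n) / log ω`. If `log (N / n) ≤ 10 log ω` this is `O(N)`, and a forest
of stars, which has no path on four vertices, suffices. Otherwise set aside about half of the
vertices as disjoint cells of at most `n / 2` vertices, each split into
`d ≈ log (N / n) / (8 log ω)` groups, and assign as many of the other vertices as possible to
cells in which they have a neighbour in every group, at most `n / 2` to a cell. Each assigned
vertex contributes `d` edges. If few vertices were assigned then, by maximality, many cells would
have no unassigned vertex left to take, and a union bound over the sets of such cells and vertices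
shows that this is unlikely.
-/

namespace PathTuran

open SimpleGraph MeasureTheory ProbabilityTheory unitInterval
open scoped Finset

section Independence

variable {Ω ι κ : Type*} {mΩ : MeasurableSpace Ω} {μ : Measure Ω}

lemma measureReal_biInter_of_iIndep {m : κ → MeasurableSpace Ω} (hm : ∀ k, m k ≤ mΩ)
    (hind : iIndep m μ) (B : Finset ι) {S : ι → Set κ} (hS : (B : Set ι).PairwiseDisjoint S)
    {E : ι → Set Ω} (hE : ∀ b ∈ B, MeasurableSet[⨆ k ∈ S b, m k] (E b)) :
    μ.real (⋂ b ∈ B, E b) = ∏ b ∈ B, μ.real (E b) := by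
  classical
  have := hind.isProbabilityMeasure
  induction B using Finset.induction_on with
  | empty => simp
  | insert a B ha ih =>
    have hB : MeasurableSet[⨆ k ∈ ⋃ b ∈ B, S b, m k] (⋂ b ∈ B, E b) := by
      refine MeasurableSet.biInter B.countable_toSet fun b hb ↦ ?_
      have hle : ⨆ k ∈ S b, m k ≤ ⨆ k ∈ ⋃ b ∈ B, S b, m k :=
        biSup_mono fun k hk ↦ Set.mem_biUnion hb hk
      exact hle _ (hE b (Finset.mem_insert_of_mem hb))
    have hdisj : Disjoint (S a) (⋃ b ∈ B, S b) := by
      refine Set.disjoint_iUnion₂_right.2 fun b hb ↦ hS (by simp) (by simp_all) ?_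
      rintro rfl
      exact ha hb
    have hinter := Indep_iff _ _ μ |>.1 (indep_iSup_of_disjoint hm hind hdisj) _ _
      (hE a (Finset.mem_insert_self a B)) hB
    rw [Finset.set_biInter_insert, Finset.prod_insert ha,
      ← ih (hS.subset (by simp)) fun b hb ↦ hE b (Finset.mem_insert_of_mem hb)]
    simp only [measureReal_def, hinter, ENNReal.toReal_mul]

lemma indepFun_indicator_one {A B : Set Ω} (h : IndepSet A B μ) :
    IndepFun (A.indicator (1 : Ω → ℝ)) (B.indicator (1 : Ω → ℝ)) μ := by
  have hcomap (C : Set Ω) : MeasurableSpace.comap (C.indicator (1 : Ω → ℝ)) inferInstance ≤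
      MeasurableSpace.generateFrom {C} := by
    have hC : MeasurableSet[MeasurableSpace.generateFrom {C}] C :=
      MeasurableSpace.measurableSet_generateFrom rfl
    have hone : Measurable[MeasurableSpace.generateFrom {C}] (1 : Ω → ℝ) := measurable_const
    exact (hone.indicator hC).comap_le
  rw [IndepSet_iff_Indep] at h
  exact indep_of_indep_of_le_left (indep_of_indep_of_le_right h (hcomap B)) (hcomap A)

lemma variance_sum_indicator_le [IsProbabilityMeasure μ] {B : Finset ι} {E : ι → Set Ω}
    (hE : ∀ b ∈ B, MeasurableSet (E b))
    (hind : (B : Set ι).Pairwise fun a b ↦ IndepSet (E a) (E b) μ) :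
    variance (∑ b ∈ B, (E b).indicator (1 : Ω → ℝ)) μ ≤ ∑ b ∈ B, μ.real (E b) := by
  have hX : ∀ b ∈ B, MemLp ((E b).indicator (1 : Ω → ℝ)) 2 μ := fun b hb ↦
    memLp_top_const (1 : ℝ) |>.mono_exponent le_top |>.indicator (hE b hb)
  rw [IndepFun.variance_sum hX fun a ha b hb hab ↦ indepFun_indicator_one (hind ha hb hab)]
  refine Finset.sum_le_sum fun b hb ↦ ?_
  refine (variance_le_expectation_sq (hX b hb).aestronglyMeasurable).trans_eq ?_
  rw [← integral_indicator_one (hE b hb)]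
  refine integral_congr_ae (.of_forall fun ω ↦ ?_)
  by_cases hω : ω ∈ E b <;> simp [hω]

open scoped Classical in
lemma measureReal_card_filter_le_of_indepSet [IsProbabilityMeasure μ] (B : Finset ι)
    {E : ι → Set Ω} (hE : ∀ b ∈ B, MeasurableSet (E b))
    (hind : (B : Set ι).Pairwise fun a b ↦ IndepSet (E a) (E b) μ)
    {M ε : ℝ} (hM : 0 < M) (hMle : M ≤ ∑ b ∈ B, μ.real (E b)) (hε : 0 < ε) (hε1 : ε ≤ 1) :
    μ.real {ω | (#{b ∈ B | ω ∈ E b} : ℝ) ≤ (1 - ε) * M} ≤ 1 / (ε ^ 2 * M) := by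
  set X : ι → Ω → ℝ := fun b ↦ (E b).indicator 1
  set m := ∑ b ∈ B, μ.real (E b)
  have hX : ∀ b ∈ B, MemLp (X b) 2 μ := fun b hb ↦
    memLp_top_const (1 : ℝ) |>.mono_exponent le_top |>.indicator (hE b hb)
  have hmean : μ[∑ b ∈ B, X b] = m := by
    simp only [Finset.sum_apply]
    rw [integral_finsetSum _ fun b hb ↦ (hX b hb).integrable (by norm_num)]
    exact Finset.sum_congr rfl fun b hb ↦ integral_indicator_one (hE b hb)
  have hsub : {ω | (#{b ∈ B | ω ∈ E b} : ℝ) ≤ (1 - ε) * M} ⊆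
      {ω | ε * m ≤ |(∑ b ∈ B, X b) ω - m|} := by
    intro ω hω
    have hsum : (∑ b ∈ B, X b) ω = (#{b ∈ B | ω ∈ E b} : ℝ) := by
      simp [X, Set.indicator_apply]
    rw [Set.mem_ofPred_eq] at hω ⊢
    rw [hsum, abs_sub_comm]
    refine le_trans ?_ (le_abs_self _)
    nlinarith
  have hm : 0 < m := hM.trans_le hMle
  have hcheb := meas_ge_le_variance_div_sq (memLp_finsetSum' B hX) (mul_pos hε hm)
  rw [hmean] at hcheb
  calc _ ≤ variance (∑ b ∈ B, X b) μ / (ε * m) ^ 2 :=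
        ENNReal.toReal_le_of_le_ofReal
          (div_nonneg (variance_nonneg _ _) (sq_nonneg _)) ((measure_mono hsub).trans hcheb)
    _ ≤ m / (ε * m) ^ 2 := by gcongr; exact variance_sum_indicator_le hE hind
    _ = 1 / (ε ^ 2 * m) := by field_simp
    _ ≤ 1 / (ε ^ 2 * M) := by gcongr

end Independence

section BinomialRandom

variable {V ι : Type*}

/-- The σ-algebra of the events that depend only on which of the pairs in `S` are edges. -/
@[reducible] def pairAlgebra (S : Set (Sym2 V)) : MeasurableSpace (SimpleGraph V) :=
  ⨆ e ∈ S, MeasurableSpace.comap (fun G : SimpleGraph V ↦ e ∈ G.edgeSet) ⊤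

lemma pairAlgebra_mono {S T : Set (Sym2 V)} (h : S ⊆ T) : pairAlgebra S ≤ pairAlgebra T :=
  biSup_mono fun _ he ↦ h he

lemma measurableSet_pairAlgebra_mem {S : Set (Sym2 V)} {e : Sym2 V} (he : e ∈ S) :
    MeasurableSet[pairAlgebra S] {G : SimpleGraph V | e ∈ G.edgeSet} := by
  have hle := le_iSup₂ (f := fun (e : Sym2 V) (_ : e ∈ S) ↦
    MeasurableSpace.comap (fun G : SimpleGraph V ↦ e ∈ G.edgeSet) ⊤) e he
  exact hle _ ⟨{True}, trivial, by ext; simp⟩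

/-- The event that some pair in `T` is an edge. -/
def hitEvent (T : Finset (Sym2 V)) : Set (SimpleGraph V) :=
  {G | ∃ e ∈ T, e ∈ G.edgeSet}

lemma measurableSet_pairAlgebra_hitEvent (T : Finset (Sym2 V)) :
    MeasurableSet[pairAlgebra (T : Set (Sym2 V))] (hitEvent T) := by
  have h : hitEvent T = ⋃ e ∈ T, {G : SimpleGraph V | e ∈ G.edgeSet} := by
    ext; simp [hitEvent]
  rw [h]
  exact T.measurableSet_biUnion fun e he ↦ measurableSet_pairAlgebra_mem he

lemma measurable_fromEdgeSet_ofPred :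
    Measurable fun ω : Sym2 V → Prop ↦ fromEdgeSet {e | ω e} :=
  measurable_fromEdgeSet.comp MeasurableEquiv.setOfPred.measurable

variable [Finite V] (p : I)

instance : DiscreteMeasurableSpace (SimpleGraph V) := by
  have : MeasurableSingletonClass (SimpleGraph V) := ⟨fun G ↦ by
    have hG : ({G} : Set (SimpleGraph V)) = edgeSet ⁻¹' {G.edgeSet} := by ext; simp
    rw [hG]
    exact measurable_edgeSet (measurableSet_singleton _)⟩
  infer_instance

/-- The law of independent `p`-Bernoulli indicators of the pairs of distinct vertices. -/
noncomputable def pairMeasure (V : Type*) (p : I) : Measure (Sym2 V → Prop) :=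
  Measure.infinitePi fun e : Sym2 V ↦
    toNNReal p • Measure.dirac (e ∈ (Sym2.diagSetᶜ : Set (Sym2 V))) +
      toNNReal (σ p) • Measure.dirac False

lemma binomialRandom_eq_map_pairMeasure : binomialRandom V p =
    (pairMeasure V p).map (fun ω : Sym2 V → Prop ↦ fromEdgeSet {e | ω e}) := by
  rw [binomialRandom_eq_map, setBernoulli_eq_map]
  exact Measure.map_map measurable_fromEdgeSet MeasurableEquiv.setOfPred.measurable

lemma iIndepFun_mem_edgeSet :
    iIndepFun (fun (e : Sym2 V) (G : SimpleGraph V) ↦ e ∈ G.edgeSet) (binomialRandom V p) := by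
  have hind : iIndepFun (fun (e : Sym2 V) (ω : Sym2 V → Prop) ↦ ω e ∧ ¬ e.IsDiag)
      (pairMeasure V p) :=
    iIndepFun_infinitePi (X := fun (e : Sym2 V) b ↦ b ∧ ¬ e.IsDiag) fun _ ↦ Measurable.of_discrete
  have hpre (e : Sym2 V) (s : Set Prop) : (fun ω : Sym2 V → Prop ↦ fromEdgeSet {e | ω e}) ⁻¹'
      ((fun G : SimpleGraph V ↦ e ∈ G.edgeSet) ⁻¹' s) = (fun ω ↦ ω e ∧ ¬ e.IsDiag) ⁻¹' s := by
    ext; simp [edgeSet_fromEdgeSet]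
  rw [iIndepFun_iff_measure_inter_preimage_eq_mul] at hind ⊢
  intro S sets _
  rw [binomialRandom_eq_map_pairMeasure,
    Measure.map_apply measurable_fromEdgeSet_ofPred MeasurableSet.of_discrete]
  simp only [Measure.map_apply measurable_fromEdgeSet_ofPred MeasurableSet.of_discrete,
    Set.preimage_iInter, hpre]
  exact hind S (sets := sets) fun _ _ ↦ MeasurableSet.of_discrete

lemma measureReal_biInter_of_pairAlgebra (B : Finset ι) {S : ι → Set (Sym2 V)}
    (hS : (B : Set ι).PairwiseDisjoint S) {E : ι → Set (SimpleGraph V)}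
    (hE : ∀ b ∈ B, MeasurableSet[pairAlgebra (S b)] (E b)) :
    (binomialRandom V p).real (⋂ b ∈ B, E b) = ∏ b ∈ B, (binomialRandom V p).real (E b) :=
  measureReal_biInter_of_iIndep (fun _ ↦ Measurable.of_discrete.comap_le)
    (iIndepFun_mem_edgeSet p) B hS hE

lemma indepSet_of_pairAlgebra {S T : Set (Sym2 V)} (hST : Disjoint S T)
    {E F : Set (SimpleGraph V)} (hE : MeasurableSet[pairAlgebra S] E)
    (hF : MeasurableSet[pairAlgebra T] F) : IndepSet E F (binomialRandom V p) :=
  (indepSet_iff_measure_inter_eq_mul .of_discrete .of_discrete _).2 <|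
    (Indep_iff _ _ _).1 (indep_iSup_of_disjoint (fun _ ↦ Measurable.of_discrete.comap_le)
      (iIndepFun_mem_edgeSet p) hST) _ _ hE hF

lemma measureReal_mem_edgeSet {e : Sym2 V} (he : ¬ e.IsDiag) :
    (binomialRandom V p).real {G | e ∈ G.edgeSet} = p := by
  have hpre : (fun ω : Sym2 V → Prop ↦ fromEdgeSet {e | ω e}) ⁻¹' {G | e ∈ G.edgeSet} =
      (fun ω ↦ ω e) ⁻¹' {True} := by
    ext; simp [edgeSet_fromEdgeSet, he]
  rw [measureReal_def, binomialRandom_eq_map_pairMeasure,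
    Measure.map_apply measurable_fromEdgeSet_ofPred MeasurableSet.of_discrete, hpre,
    ← Measure.map_apply (by fun_prop) MeasurableSet.of_discrete,
    pairMeasure, Measure.infinitePi_map_eval]
  simp [he]

lemma measureReal_subset_edgeSet_le (T : Finset (Sym2 V)) :
    (binomialRandom V p).real {G | ∀ e ∈ T, e ∈ G.edgeSet} ≤ (p : ℝ) ^ #T := by
  have hprod := measureReal_biInter_of_pairAlgebra p T (S := fun e ↦ {e})
    (E := fun e ↦ {G | e ∈ G.edgeSet}) (fun a _ b _ hab ↦ by simpa using hab)
    fun e _ ↦ measurableSet_pairAlgebra_mem rfl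
  have hT : {G : SimpleGraph V | ∀ e ∈ T, e ∈ G.edgeSet} = ⋂ e ∈ T, {G | e ∈ G.edgeSet} := by
    ext; simp
  rw [hT, hprod, ← Finset.prod_const]
  refine Finset.prod_le_prod (fun _ _ ↦ measureReal_nonneg) fun e _ ↦ ?_
  by_cases he : e.IsDiag
  · have hempty : {G : SimpleGraph V | e ∈ G.edgeSet} = ∅ :=
      Set.eq_empty_of_forall_notMem fun G hG ↦ G.not_isDiag_of_mem_edgeSet hG he
    simpa [hempty] using p.2.1
  · exact (measureReal_mem_edgeSet p he).le

lemma measureReal_hitEvent {T : Finset (Sym2 V)} (hT : ∀ e ∈ T, ¬ e.IsDiag) :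
    (binomialRandom V p).real (hitEvent T) = 1 - (1 - p : ℝ) ^ #T := by
  have hprod := measureReal_biInter_of_pairAlgebra p T (S := fun e ↦ {e})
    (E := fun e ↦ {G | e ∈ G.edgeSet}ᶜ) (fun a _ b _ hab ↦ by simpa using hab)
    fun e _ ↦ MeasurableSet.compl (measurableSet_pairAlgebra_mem rfl)
  have hcompl : hitEvent T = (⋂ e ∈ T, {G | e ∈ G.edgeSet}ᶜ)ᶜ := by
    ext; simp [hitEvent]
  have hmiss : ∀ e ∈ T, (binomialRandom V p).real {G | e ∈ G.edgeSet}ᶜ = 1 - p := fun e he ↦ by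
    rw [probReal_compl_eq_one_sub MeasurableSet.of_discrete, measureReal_mem_edgeSet p (hT e he)]
  rw [hcompl, probReal_compl_eq_one_sub MeasurableSet.of_discrete, hprod,
    Finset.prod_congr rfl hmiss, Finset.prod_const]

open scoped Classical in
lemma measureReal_card_hitEvent_le (B : Finset ι) {T : ι → Finset (Sym2 V)} {c : ℕ}
    (hT : ∀ b ∈ B, ∀ e ∈ T b, ¬ e.IsDiag) (hc : ∀ b ∈ B, #(T b) = c)
    (hdisj : (B : Set ι).PairwiseDisjoint T) {M ε : ℝ} (hM : 0 < M)
    (hMle : M ≤ #B * (1 - (1 - p : ℝ) ^ c)) (hε : 0 < ε) (hε1 : ε ≤ 1) :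
    (binomialRandom V p).real {G | (#{b ∈ B | G ∈ hitEvent (T b)} : ℝ) ≤ (1 - ε) * M} ≤
      1 / (ε ^ 2 * M) := by
  refine measureReal_card_filter_le_of_indepSet B (fun _ _ ↦ .of_discrete) ?_ hM ?_ hε hε1
  · intro a ha b hb hab
    exact indepSet_of_pairAlgebra p (Finset.disjoint_coe.2 (hdisj ha hb hab))
      (measurableSet_pairAlgebra_hitEvent _) (measurableSet_pairAlgebra_hitEvent _)
  · refine hMle.trans_eq ?_
    rw [Finset.sum_congr rfl fun b hb ↦ (measureReal_hitEvent p (hT b hb)).trans (by rw [hc b hb]),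
      Finset.sum_const, nsmul_eq_mul]

end BinomialRandom

section RelativeExtremalNumber

variable {V W : Type*} [Fintype V]

lemma ncard_edgeSet_le_exIn {G H : SimpleGraph V} {F : SimpleGraph W} (hHG : H ≤ G)
    (hF : F.Free H) : H.edgeSet.ncard ≤ G.exIn F := by
  classical
  rw [exIn, ← coe_edgeFinset, Set.ncard_coe_finset]
  convert Finset.le_sup (f := fun H : SimpleGraph V ↦ H.edgeFinset.card) (b := H) ?_ using 2
  simpa [hHG] using hF

lemma exIn_le {G : SimpleGraph V} {F : SimpleGraph W} {t : ℕ}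
    (h : ∀ H ≤ G, F.Free H → H.edgeSet.ncard ≤ t) : G.exIn F ≤ t := by
  classical
  refine Finset.sup_le fun H hH ↦ ?_
  simp only [Finset.mem_filter, Finset.mem_univ, true_and] at hH
  refine (h H hH.1 hH.2).trans' ?_
  rw [← coe_edgeFinset, Set.ncard_coe_finset]

lemma exIn_le_ncard_edgeSet (G : SimpleGraph V) (F : SimpleGraph W) :
    G.exIn F ≤ G.edgeSet.ncard :=
  exIn_le fun _ hH _ ↦ Set.ncard_le_ncard (edgeSet_mono hH)

end RelativeExtremalNumber

section SpannedPairs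

variable {V : Type*}

open scoped Classical in
/-- The pairs of distinct vertices of `A`. -/
noncomputable def spannedPairs (A : Finset V) : Finset (Sym2 V) :=
  A.offDiag.image Sym2.mk.uncurry

lemma mk_mem_spannedPairs {A : Finset V} {x y : V} :
    s(x, y) ∈ spannedPairs A ↔ x ∈ A ∧ y ∈ A ∧ x ≠ y := by
  simp only [spannedPairs, Finset.mem_image, Finset.mem_offDiag, Prod.exists,
    Function.uncurry_apply_pair, Sym2.eq_iff]
  grind

lemma card_spannedPairs (A : Finset V) : #(spannedPairs A) = (#A).choose 2 := by
  classical
  exact Sym2.card_image_offDiag A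

lemma spannedPairs_mono {A B : Finset V} (h : A ⊆ B) : spannedPairs A ⊆ spannedPairs B := by
  intro e he
  induction e with | _ x y =>
  obtain ⟨hx, hy, hxy⟩ := mk_mem_spannedPairs.1 he
  exact mk_mem_spannedPairs.2 ⟨h hx, h hy, hxy⟩

end SpannedPairs

section DepthFirstSearch

variable {V : Type*} {H : SimpleGraph V} {p : List V} {U : Finset V} {n : ℕ}

lemma length_le_of_pathGraph_free (hF : (pathGraph (n + 1)).Free H) (hc : p.IsChain H.Adj)
    (hp : p.Nodup) : p.length ≤ n := by
  by_contra! hlt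
  refine hF ⟨⟨⟨fun i : Fin (n + 1) ↦ p[i.1], ?_⟩, ?_⟩⟩
  · intro a b hab
    rw [pathGraph_adj] at hab
    rw [List.isChain_iff_getElem] at hc
    rcases hab with h | h
    · simpa [h] using hc a.1 (by omega)
    · simpa [h] using (hc b.1 (by omega)).symm
  · exact fun a b hab ↦ Fin.ext (hp.getElem_inj_iff.1 hab)

/-- A state of a depth-first search in `H`: `p` is the current stack, a path of discovered
vertices, and `U` is the set of undiscovered vertices, which sends no edges to finished ones. -/
structure IsSearchState (H : SimpleGraph V) (p : List V) (U : Finset V) : Prop where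
  isChain : p.IsChain H.Adj
  nodup : p.Nodup
  notMem : ∀ x ∈ p, x ∉ U
  adj : ∀ x ∈ U, ∀ y, H.Adj x y → y ∈ U ∨ y ∈ p

lemma isSearchState_nil_univ [Fintype V] : IsSearchState H [] Finset.univ :=
  ⟨.nil, List.nodup_nil, by simp, by simp⟩

lemma IsSearchState.exists_backtrack (h : IsSearchState H p U) (hU : U.Nonempty) :
    ∃ q, IsSearchState H q U ∧ ∃ u ∈ U, (u :: q).IsChain H.Adj := by
  induction p with
  | nil => exact ⟨[], h, hU.choose, hU.choose_spec, .singleton _⟩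
  | cons a p ih =>
    by_cases ha : ∃ u ∈ U, H.Adj u a
    · obtain ⟨u, hu, hua⟩ := ha
      exact ⟨a :: p, h, u, hu, h.isChain.cons_cons hua⟩
    · refine ih ⟨h.isChain.tail, h.nodup.of_cons,
        fun x hx ↦ h.notMem x (List.mem_cons_of_mem _ hx), fun x hx y hxy ↦ ?_⟩
      refine (h.adj x hx y hxy).imp_right fun hy ↦ (List.mem_cons.1 hy).resolve_left ?_
      rintro rfl
      exact ha ⟨x, hx, hxy⟩

lemma IsSearchState.discover [DecidableEq V] (h : IsSearchState H p U) {u : V} (hu : u ∈ U)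
    (hc : (u :: p).IsChain H.Adj) : IsSearchState H (u :: p) (U.erase u) where
  isChain := hc
  nodup := List.nodup_cons.2 ⟨fun hup ↦ h.notMem u hup hu, h.nodup⟩
  notMem x hx hxU := by
    obtain ⟨hxu, hxU⟩ := Finset.mem_erase.1 hxU
    exact h.notMem x ((List.mem_cons.1 hx).resolve_left hxu) hxU
  adj x hx y hxy := by
    have := h.adj x (Finset.mem_of_mem_erase hx) y hxy
    simp only [Finset.mem_erase, List.mem_cons]
    tauto

lemma IsSearchState.exists_subset_card_add_eq (h : IsSearchState H p U) {k : ℕ}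
    (hk : k ≤ #U) : ∃ q, ∃ U' ⊆ U, #U' + k = #U ∧ IsSearchState H q U' := by
  classical
  induction k with
  | zero => exact ⟨p, U, subset_rfl, rfl, h⟩
  | succ k ih =>
    obtain ⟨q, U', hU', hcard, hs⟩ := ih (by omega)
    obtain ⟨q', hs', u, hu, hc⟩ := hs.exists_backtrack (Finset.card_pos.1 (by omega))
    refine ⟨u :: q', U'.erase u, (Finset.erase_subset _ _).trans hU', ?_, hs'.discover hu hc⟩
    have := Finset.card_erase_add_one hu
    omega

open scoped Classical in
lemma IsSearchState.edgeSet_meeting_subset (h : IsSearchState H p U) (U' : Finset V) :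
    {e ∈ H.edgeSet | ∃ x ∈ e, x ∈ U} ⊆ {e ∈ H.edgeSet | ∃ x ∈ e, x ∈ U'} ∪
      (H.edgeSet ∩ spannedPairs (p.toFinset ∪ (U \ U'))) := by
  rintro e ⟨he, x, hxe, hxU⟩
  obtain ⟨y, rfl⟩ := hxe
  by_cases hU' : x ∈ U' ∨ y ∈ U'
  · exact .inl ⟨he, by simpa using hU'⟩
  push Not at hU'
  refine .inr ⟨he, mk_mem_spannedPairs.2 ⟨?_, ?_, H.ne_of_adj he⟩⟩
  · exact Finset.mem_union_right _ (Finset.mem_sdiff.2 ⟨hxU, hU'.1⟩)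
  · rcases h.adj x hxU y he with hy | hy
    · exact Finset.mem_union_right _ (Finset.mem_sdiff.2 ⟨hy, hU'.2⟩)
    · exact Finset.mem_union_left _ (List.mem_toFinset.2 hy)

-- Each block of `n` discoveries contributes only edges spanned by the block and the current stack.
lemma IsSearchState.ncard_edgeSet_meeting_le [Finite V] {t : ℕ}
    (hF : (pathGraph (n + 1)).Free H)
    (ht : ∀ A : Finset V, #A ≤ 2 * n → (H.edgeSet ∩ spannedPairs A).ncard ≤ t)
    (b : ℕ) (h : IsSearchState H p U) (hb : #U ≤ b * n) :
    {e ∈ H.edgeSet | ∃ x ∈ e, x ∈ U}.ncard ≤ b * t := by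
  classical
  induction b generalizing p U with
  | zero =>
    have hU : U = ∅ := Finset.card_eq_zero.1 (by omega)
    simp [hU]
  | succ b ih =>
    obtain ⟨q, U', hU', hcard, hs⟩ :=
      h.exists_subset_card_add_eq (k := min n #U) (min_le_right _ _)
    have hrest := ih hs (by rw [add_mul] at hb; omega)
    have hblock : #(p.toFinset ∪ (U \ U')) ≤ 2 * n := by
      have hlen := length_le_of_pathGraph_free hF h.isChain h.nodup
      have hp := p.toFinset_card_le
      have hdiff := Finset.card_sdiff_of_subset hU'
      have hunion := Finset.card_union_le p.toFinset (U \ U')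
      omega
    calc _ ≤ _ := Set.ncard_le_ncard (h.edgeSet_meeting_subset U') (Set.toFinite _)
      _ ≤ _ := Set.ncard_union_le _ _
      _ ≤ b * t + t := add_le_add hrest (ht _ hblock)
      _ = (b + 1) * t := by ring

lemma exIn_pathGraph_le [Fintype V] {G : SimpleGraph V} {t : ℕ} (hn : 0 < n)
    (ht : ∀ A : Finset V, #A ≤ 2 * n → (G.edgeSet ∩ spannedPairs A).ncard ≤ t) :
    G.exIn (pathGraph (n + 1)) ≤ (Fintype.card V / n + 1) * t := by
  refine exIn_le fun H hHG hF ↦ ?_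
  have htH (A : Finset V) (hA : #A ≤ 2 * n) : (H.edgeSet ∩ spannedPairs A).ncard ≤ t :=
    (ht A hA).trans' <| Set.ncard_le_ncard (Set.inter_subset_inter_left _ (edgeSet_mono hHG))
  have hcard : (Finset.univ : Finset V).card ≤ (Fintype.card V / n + 1) * n :=
    (Nat.lt_mul_of_div_lt (Nat.lt_succ_self _) hn).le
  convert isSearchState_nil_univ.ncard_edgeSet_meeting_le hF htH _ hcard using 2
  ext e
  induction e with | _ x y => simp

end DepthFirstSearch

section UpperTail

variable {V : Type*} (p : I) {n : ℕ} {τ c : ℝ}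

lemma measureReal_lt_ncard_inter_le_choose [Finite V] (T : Finset (Sym2 V)) (hτ : 0 ≤ τ) :
    (binomialRandom V p).real {G | τ < ((G.edgeSet ∩ T).ncard : ℝ)} ≤
      (#T).choose (⌊τ⌋₊ + 1) * (p : ℝ) ^ (⌊τ⌋₊ + 1) := by
  classical
  set s := ⌊τ⌋₊ + 1
  have hsub : {G : SimpleGraph V | τ < ((G.edgeSet ∩ T).ncard : ℝ)} ⊆
      ⋃ S ∈ T.powersetCard s, {G | ∀ e ∈ S, e ∈ G.edgeSet} := by
    intro G hG
    have hcard : s ≤ #{e ∈ T | e ∈ G.edgeSet} := by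
      have hinter : G.edgeSet ∩ T = ({e ∈ T | e ∈ G.edgeSet} : Finset (Sym2 V)) := by
        ext; simp [and_comm]
      rw [Set.mem_ofPred_eq, hinter, Set.ncard_coe_finset] at hG
      exact Nat.succ_le_of_lt ((Nat.floor_lt hτ).2 hG)
    obtain ⟨S, hS, hScard⟩ := Finset.exists_subset_card_eq hcard
    simp only [Set.mem_iUnion]
    exact ⟨S, Finset.mem_powersetCard.2 ⟨hS.trans (Finset.filter_subset _ _), hScard⟩,
      fun e he ↦ (Finset.mem_filter.1 (hS he)).2⟩
  calc _ ≤ _ := measureReal_mono hsub (measure_ne_top _ _)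
    _ ≤ ∑ S ∈ T.powersetCard s, (binomialRandom V p).real {G | ∀ e ∈ S, e ∈ G.edgeSet} :=
        measureReal_biUnion_finset_le _ _
    _ ≤ ∑ _S ∈ T.powersetCard s, (p : ℝ) ^ s := Finset.sum_le_sum fun S hS ↦ by
        simpa only [(Finset.mem_powersetCard.1 hS).2] using measureReal_subset_edgeSet_le p S
    _ = (#T).choose s * (p : ℝ) ^ s := by simp

lemma measureReal_lt_ncard_inter_le [Finite V] (T : Finset (Sym2 V)) (hτ : 0 ≤ τ) (hc : 0 ≤ c)
    (hT : #T * (p : ℝ) ≤ τ * Real.exp (-c)) :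
    (binomialRandom V p).real {G | τ < ((G.edgeSet ∩ T).ncard : ℝ)} ≤ Real.exp (τ - c * τ) := by
  set s := ⌊τ⌋₊ + 1
  have hτs : τ ≤ s := by simpa [s] using (Nat.lt_floor_add_one τ).le
  have hp : (0 : ℝ) ≤ p := p.2.1
  calc _ ≤ (#T).choose s * (p : ℝ) ^ s := measureReal_lt_ncard_inter_le_choose p T hτ
    _ ≤ (#T : ℝ) ^ s / s.factorial * (p : ℝ) ^ s := by
        gcongr
        exact Nat.choose_le_pow_div _ _
    _ = (#T * (p : ℝ)) ^ s / s.factorial := by ring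
    _ ≤ (τ * Real.exp (-c)) ^ s / s.factorial := by gcongr
    _ = τ ^ s / s.factorial * Real.exp (-c) ^ s := by ring
    _ ≤ Real.exp τ * Real.exp (-(c * τ)) := by
        gcongr
        · exact Real.pow_div_factorial_le_exp τ hτ s
        · rw [← Real.exp_nat_mul, Real.exp_le_exp]
          nlinarith
    _ = Real.exp (τ - c * τ) := by rw [← Real.exp_add, sub_eq_add_neg]

lemma choose_le_exp {N k : ℕ} (hk : 0 < k) (hN : 0 < N) :
    (N.choose k : ℝ) ≤ Real.exp (k * (Real.log (N / k) + 1)) := by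
  have hk' : (0 : ℝ) < k := by exact_mod_cast hk
  have : (0 : ℝ) < N := by exact_mod_cast hN
  calc (N.choose k : ℝ) ≤ (N : ℝ) ^ k / k.factorial := Nat.choose_le_pow_div _ _
    _ = ((N : ℝ) / k) ^ k * ((k : ℝ) ^ k / k.factorial) := by
        rw [div_pow]
        field_simp
    _ ≤ ((N : ℝ) / k) ^ k * Real.exp k := by
        gcongr
        exact Real.pow_div_factorial_le_exp _ hk'.le k
    _ = Real.exp (k * (Real.log (N / k) + 1)) := by
        rw [mul_add, mul_one, Real.exp_add, Real.exp_nat_mul, Real.exp_log (by positivity)]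

lemma measureReal_lt_ncard_spannedPairs_le [Finite V] (A : Finset V) (hτ : 0 ≤ τ) (hc : 0 ≤ c)
    (hA : (#A : ℝ) ^ 2 / 2 * p ≤ τ * Real.exp (-c)) :
    (binomialRandom V p).real {G | τ < ((G.edgeSet ∩ spannedPairs A).ncard : ℝ)} ≤
      Real.exp (τ - c * τ) := by
  refine measureReal_lt_ncard_inter_le p _ hτ hc (hA.trans' ?_)
  rw [card_spannedPairs, Nat.cast_choose_two]
  have hp : (0 : ℝ) ≤ p := p.2.1
  gcongr
  nlinarith [(#A).cast_nonneg (α := ℝ)]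

variable [Fintype V]

lemma measureReal_exists_lt_ncard_spannedPairs_le (hn : 0 < n) (hV : n ≤ Fintype.card V)
    (hτ : 0 ≤ τ) (hc : 0 ≤ c) (hμ : (n : ℝ) ^ 2 / 2 * p ≤ τ * Real.exp (-c)) :
    (binomialRandom V p).real {G | ∃ A : Finset V, #A ≤ n ∧
      τ < ((G.edgeSet ∩ spannedPairs A).ncard : ℝ)} ≤
      Real.exp (n * (Real.log (Fintype.card V / n) + 1) + (τ - c * τ)) := by
  have hsub : {G : SimpleGraph V | ∃ A : Finset V, #A ≤ n ∧
      τ < ((G.edgeSet ∩ spannedPairs A).ncard : ℝ)} ⊆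
      ⋃ A ∈ (Finset.univ : Finset V).powersetCard n,
        {G | τ < ((G.edgeSet ∩ spannedPairs A).ncard : ℝ)} := by
    rintro G ⟨A, hA, hlt⟩
    obtain ⟨B, hAB, -, hB⟩ := Finset.exists_subsuperset_card_eq (Finset.subset_univ A) hA
      (by simpa using hV)
    simp only [Set.mem_iUnion]
    refine ⟨B, by simp [hB], hlt.trans_le ?_⟩
    exact_mod_cast Set.ncard_le_ncard (Set.inter_subset_inter_right _ (spannedPairs_mono hAB))
  calc _ ≤ _ := measureReal_mono hsub (measure_ne_top _ _)
    _ ≤ ∑ A ∈ (Finset.univ : Finset V).powersetCard n, (binomialRandom V p).real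
        {G | τ < ((G.edgeSet ∩ spannedPairs A).ncard : ℝ)} := measureReal_biUnion_finset_le _ _
    _ ≤ ∑ _A ∈ (Finset.univ : Finset V).powersetCard n, Real.exp (τ - c * τ) :=
        Finset.sum_le_sum fun A hA ↦ measureReal_lt_ncard_spannedPairs_le p A hτ hc <| by
          rwa [(Finset.mem_powersetCard.1 hA).2]
    _ = ((Fintype.card V).choose n : ℝ) * Real.exp (τ - c * τ) := by simp
    _ ≤ Real.exp (n * (Real.log (Fintype.card V / n) + 1)) * Real.exp (τ - c * τ) := by
        gcongr
        exact choose_le_exp hn (hn.trans_le hV)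
    _ = Real.exp (n * (Real.log (Fintype.card V / n) + 1) + (τ - c * τ)) :=
        (Real.exp_add _ _).symm

lemma measureReal_lt_exIn_pathGraph_le (hn : 0 < n) (hV : 2 * n ≤ Fintype.card V) {X : ℝ}
    (hτ : 0 ≤ τ) (hc : 0 ≤ c) (hμ : 2 * (n : ℝ) ^ 2 * p ≤ τ * Real.exp (-c))
    (hX : ((Fintype.card V : ℝ) / n + 1) * τ ≤ X) :
    (binomialRandom V p).real {G | X < (G.exIn (pathGraph (n + 1)) : ℝ)} ≤
      Real.exp (2 * n * (Real.log (Fintype.card V / (2 * n)) + 1) + (τ - c * τ)) := by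
  have hspan := measureReal_exists_lt_ncard_spannedPairs_le (n := 2 * n) p (by omega) hV hτ hc
    (hμ.trans' (by push_cast; linarith))
  push_cast at hspan
  refine (measureReal_mono fun G hG ↦ ?_).trans hspan
  by_contra hcon
  simp only [Set.mem_ofPred_eq, not_exists, not_and, not_lt] at hcon hG
  have hex := exIn_pathGraph_le (G := G) (t := ⌊τ⌋₊) hn fun A hA ↦ Nat.le_floor (hcon A hA)
  refine hG.not_ge (hX.trans' ?_)
  calc (G.exIn (pathGraph (n + 1)) : ℝ)
      ≤ ((Fintype.card V / n + 1 : ℕ) : ℝ) * (⌊τ⌋₊ : ℝ) := by exact_mod_cast hex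
    _ ≤ ((Fintype.card V : ℝ) / n + 1) * τ := by
        push_cast
        gcongr
        · exact Nat.cast_div_le
        · exact Nat.floor_le hτ

lemma measureReal_lt_exIn_le {W : Type*} (F : SimpleGraph W) (hτ : 0 ≤ τ) (hc : 0 ≤ c)
    (hμ : (Fintype.card V : ℝ) ^ 2 / 2 * p ≤ τ * Real.exp (-c)) :
    (binomialRandom V p).real {G | τ < (G.exIn F : ℝ)} ≤ Real.exp (τ - c * τ) := by
  have hedges (G : SimpleGraph V) :
      G.edgeSet ⊆ ↑(spannedPairs (Finset.univ : Finset V)) := by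
    intro e he
    induction e with | _ x y =>
    exact mk_mem_spannedPairs.2 ⟨Finset.mem_univ x, Finset.mem_univ y, G.ne_of_adj he⟩
  refine (measureReal_mono fun G hG ↦ ?_).trans
    (measureReal_lt_ncard_spannedPairs_le p Finset.univ hτ hc hμ)
  rw [Set.mem_ofPred_eq] at hG ⊢
  rw [Set.inter_eq_self_of_subset_left (hedges G)]
  exact hG.trans_le (mod_cast exIn_le_ncard_edgeSet G F)

end UpperTail

section Constructions

variable {V ι : Type*} {H : SimpleGraph V} {n : ℕ}

lemma pathGraph_free_of_fibers [Finite V] (f : V → ι)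
    (hf : ∀ x y, H.Adj x y → f x = f y ∧ {z | f z = f x}.ncard ≤ n) (hn : 0 < n) :
    (pathGraph (n + 1)).Free H := by
  rintro ⟨φ⟩
  have hadj (k : ℕ) (hk : k + 1 < n + 1) : H.Adj (φ ⟨k, by omega⟩) (φ ⟨k + 1, hk⟩) :=
    φ.toHom.map_adj (by simp [pathGraph_adj])
  have hconst (k : ℕ) (hk : k < n + 1) : f (φ ⟨k, hk⟩) = f (φ 0) := by
    induction k with
    | zero => rfl
    | succ k ih => exact (hf _ _ (hadj k hk)).1.symm.trans (ih (by omega))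
  have hrange : Set.range φ ⊆ {z | f z = f (φ 0)} := by
    rintro _ ⟨k, rfl⟩
    exact hconst k k.2
  have hcard : (Set.range φ).ncard = n + 1 := by
    simpa using Set.ncard_range_of_injective φ.injective
  have hle := (Set.ncard_le_ncard hrange).trans (hf _ _ (hadj 0 (by omega))).2
  omega

lemma pathGraph_free_of_forall_adj_isLeaf
    (hH : ∀ x y, H.Adj x y → (∀ z, H.Adj x z → z = y) ∨ ∀ z, H.Adj y z → z = x)
    (hn : 3 ≤ n) : (pathGraph (n + 1)).Free H := by
  rintro ⟨φ⟩
  have hadj (k : ℕ) (hk : k + 1 < n + 1) : H.Adj (φ ⟨k, by omega⟩) (φ ⟨k + 1, hk⟩) :=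
    φ.toHom.map_adj (by simp [pathGraph_adj])
  rcases hH _ _ (hadj 1 (by omega)) with h | h
  · simpa using Fin.mk.inj (φ.injective (h _ (hadj 0 (by omega)).symm))
  · simpa using Fin.mk.inj (φ.injective (h _ (hadj 2 (by omega))))

open scoped Classical in
lemma card_filter_exists_adj_le_exIn [Fintype V] (G : SimpleGraph V) (R : Finset V) (hn : 3 ≤ n) :
    #{v ∈ R | ∃ w ∉ R, G.Adj v w} ≤ G.exIn (pathGraph (n + 1)) := by
  set L : Finset V := {v ∈ R | ∃ w ∉ R, G.Adj v w}
  have hL {v : V} : v ∈ L ↔ v ∈ R ∧ ∃ w ∉ R, G.Adj v w := Finset.mem_filter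
  have hex (v : V) (hv : v ∈ L) : ∃ w, w ∉ R ∧ G.Adj v w := (hL.1 hv).2
  choose! g hgR hgG using hex
  let S : SimpleGraph V :=
    { Adj x y := (x ∈ L ∧ y = g x) ∨ (y ∈ L ∧ x = g y)
      symm := ⟨fun _ _ ↦ Or.symm⟩
      loopless := ⟨fun x h ↦ by
        obtain ⟨hx, hxg⟩ := h.elim id id
        exact (hgG x hx).ne hxg⟩ }
  have hSG : S ≤ G := by
    rintro x y (⟨hx, rfl⟩ | ⟨hy, rfl⟩)
    exacts [hgG x hx, (hgG y hy).symm]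
  have hleaf {x z : V} (hx : x ∈ L) (hxz : S.Adj x z) : z = g x := by
    rcases hxz with ⟨-, h⟩ | ⟨hz, rfl⟩
    exacts [h, absurd (hL.1 hx).1 (hgR z hz)]
  have hfree : (pathGraph (n + 1)).Free S := by
    refine pathGraph_free_of_forall_adj_isLeaf ?_ hn
    rintro x y (⟨hx, rfl⟩ | ⟨hy, rfl⟩)
    exacts [.inl fun z ↦ hleaf hx, .inr fun z ↦ hleaf hy]
  refine (ncard_edgeSet_le_exIn hSG hfree).trans' ?_
  rw [← Set.ncard_coe_finset]
  refine Set.ncard_le_ncard_of_injOn (fun v ↦ s(v, g v)) (fun v hv ↦ .inl ⟨hv, rfl⟩) ?_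
  intro v hv w hw hvw
  rcases Sym2.eq_iff.1 hvw with h | h
  · exact h.1
  · exact absurd (hL.1 hv).1 (h.1 ▸ hgR w hw)

end Constructions

section Assignment

variable {ι β : Type*} [Fintype β] {r : ι → β → Prop} {s : ℕ} {a : β → Option ι}

open scoped Classical in
/-- A partial assignment `a` of the elements of `β` to the elements of `ι`, with `none` standing for
unassigned, that respects the relation `r` and assigns at most `s` elements to each `i`. -/
structure IsAssignment (r : ι → β → Prop) (s : ℕ) (a : β → Option ι) : Prop where
  rel : ∀ {v i}, a v = some i → r i v
  card_le : ∀ i, #{v | a v = some i} ≤ s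

open scoped Classical in
lemma IsAssignment.update (ha : IsAssignment r s a) {i : ι} {v : β} (hi : #{w | a w = some i} < s)
    (hr : r i v) : IsAssignment r s (Function.update a v (some i)) where
  rel {w j} hw := by
    by_cases hwv : w = v
    · subst hwv
      rw [Function.update_self, Option.some_inj] at hw
      exact hw ▸ hr
    · exact ha.rel (Function.update_of_ne hwv (some i) a ▸ hw)
  card_le j := by
    by_cases hj : j = i
    · subst hj
      refine (Finset.card_le_card fun w hw ↦ ?_).trans
        ((Finset.card_insert_le v ({w | a w = some j} : Finset β)).trans hi)
      by_cases hwv : w = v <;> simp_all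
    · refine (Finset.card_le_card fun w hw ↦ ?_).trans (ha.card_le j)
      by_cases hwv : w = v
      · simp_all [eq_comm]
      · simp_all

variable [Fintype ι]

open scoped Classical in
lemma card_filter_ne_none_eq_sum (a : β → Option ι) :
    #{v | a v ≠ none} = ∑ i, #{v | a v = some i} := by
  rw [← Finset.card_biUnion]
  · congr 1
    ext v
    simp [Option.ne_none_iff_exists']
  · intro i _ j _ hij
    refine Finset.disjoint_filter.2 fun v _ hi hj ↦ hij ?_
    exact Option.some_injective _ (hi.symm.trans hj)

open scoped Classical in
lemma exists_isAssignment (h : ∀ (J : Finset ι) (U : Finset β), Fintype.card ι ≤ 2 * #J →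
      Fintype.card β ≤ #U + Fintype.card ι * s → ∃ i ∈ J, ∃ v ∈ U, r i v) :
    ∃ a, IsAssignment r s a ∧ Fintype.card ι * s ≤ 2 * #{v | a v ≠ none} := by
  obtain ⟨a, ha, hmax⟩ := Finset.exists_max_image {a | IsAssignment r s a}
    (fun a : β → Option ι ↦ #{v | a v ≠ none})
    ⟨fun _ ↦ none, by simpa using ⟨by simp, by simp⟩⟩
  replace ha : IsAssignment r s a := by simpa using ha
  refine ⟨a, ha, ?_⟩
  set J : Finset ι := {i | #{v | a v = some i} < s}
  set U : Finset β := {v | a v = none}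
  have hsum := card_filter_ne_none_eq_sum a
  have hU : #U + #{v | a v ≠ none} = Fintype.card β :=
    Finset.card_filter_add_card_filter_not fun v ↦ a v = none
  have hupper : #{v | a v ≠ none} ≤ Fintype.card ι * s :=
    hsum.trans_le (Finset.sum_le_card_nsmul _ _ s fun i _ ↦ ha.card_le i)
  have hlower : #Jᶜ * s ≤ #{v | a v ≠ none} := by
    rw [hsum]
    refine (Finset.card_nsmul_le_sum Jᶜ _ s fun i hi ↦ ?_).trans
      (Finset.sum_le_sum_of_subset (Finset.subset_univ _))
    simpa [J] using hi
  have hJ : 2 * #J < Fintype.card ι := by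
    by_contra! hJ
    obtain ⟨i, hi, v, hv, hr⟩ := h J U hJ (by omega)
    have hav : a v = none := (Finset.mem_filter.1 hv).2
    have hupd := ha.update (Finset.mem_filter.1 hi).2 hr
    refine (hmax _ (by simpa using hupd)).not_gt (Finset.card_lt_card ?_)
    refine (Finset.ssubset_iff_of_subset fun w hw ↦ ?_).2 ⟨v, by simp, by simp [hav]⟩
    by_cases hwv : w = v <;> simp_all
  have hJc : #J + #Jᶜ = Fintype.card ι := Finset.card_add_card_compl J
  calc Fintype.card ι * s ≤ 2 * #Jᶜ * s := by gcongr; omega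
    _ ≤ 2 * #{v | a v ≠ none} := by rw [mul_assoc]; gcongr

end Assignment

section Cells

variable {V ι κ γ β : Type*}

/-- With the cell `i` consisting of the groups `{φ (i, j, l) | l : γ}`, `j : κ`, the outer vertex
`v` has a neighbour in each group of the cell. -/
def SeesCell (G : SimpleGraph V) (φ : (ι × κ × γ) ⊕ β ↪ V) (i : ι) (v : β) : Prop :=
  ∀ j, ∃ l, G.Adj (φ (.inl (i, j, l))) (φ (.inr v))

/-- The cell to which a vertex belongs once the outer vertices are distributed by `a`. -/
noncomputable def cellOf (φ : (ι × κ × γ) ⊕ β ↪ V) (a : β → Option ι) : V → Option ι :=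
  Function.extend φ (Sum.elim (fun x ↦ some x.1) a) fun _ ↦ none

/-- The edges of `G` inside the cells enlarged by their assigned outer vertices. -/
def cellGraph (G : SimpleGraph V) (φ : (ι × κ × γ) ⊕ β ↪ V) (a : β → Option ι) : SimpleGraph V where
  Adj x y := G.Adj x y ∧ cellOf φ a x = cellOf φ a y ∧ cellOf φ a x ≠ none
  symm := ⟨fun _ _ h ↦ ⟨h.1.symm, h.2.1.symm, h.2.1 ▸ h.2.2⟩⟩
  loopless := ⟨fun _ h ↦ h.1.ne rfl⟩

variable (G : SimpleGraph V) (φ : (ι × κ × γ) ⊕ β ↪ V) {a : β → Option ι} {s n : ℕ}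

lemma cellOf_inl (a : β → Option ι) (x : ι × κ × γ) : cellOf φ a (φ (.inl x)) = some x.1 :=
  φ.injective.extend_apply _ _ _

lemma cellOf_inr (a : β → Option ι) (v : β) : cellOf φ a (φ (.inr v)) = a v :=
  φ.injective.extend_apply _ _ _

open scoped Classical in
lemma ncard_cellOf_eq_some_le [Fintype κ] [Fintype γ] [Fintype β] (a : β → Option ι) (i : ι) :
    {x | cellOf φ a x = some i}.ncard ≤
      Fintype.card κ * Fintype.card γ + #{v | a v = some i} := by
  let T : Finset ((ι × κ × γ) ⊕ β) := Finset.disjSum ({i} ×ˢ .univ) {v | a v = some i}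
  have hT : {x | cellOf φ a x = some i} ⊆ (T.map φ : Finset V) := by
    intro x hx
    rw [Set.mem_ofPred_eq] at hx
    obtain ⟨z, rfl⟩ : ∃ z, φ z = x := by
      by_contra hxφ
      simp [cellOf, Function.extend_apply' _ _ _ hxφ] at hx
    refine Finset.mem_coe.2 (Finset.mem_map_of_mem _ ?_)
    rcases z with z | v
    · rw [cellOf_inl, Option.some_inj] at hx
      simp [T, ← hx]
    · rw [cellOf_inr] at hx
      simp [T, hx]
  refine (Set.ncard_le_ncard hT (Finset.finite_toSet _)).trans_eq ?_
  rw [Set.ncard_coe_finset, Finset.card_map, Finset.card_disjSum]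
  simp

variable [Fintype κ] [Fintype β]

lemma pathGraph_free_cellGraph [Finite V] [Fintype γ]
    (ha : IsAssignment (SeesCell G φ) s a) (hn : 0 < n)
    (hcell : Fintype.card κ * Fintype.card γ + s ≤ n) :
    (pathGraph (n + 1)).Free (cellGraph G φ a) := by
  refine pathGraph_free_of_fibers (cellOf φ a) (fun x y hxy ↦ ⟨hxy.2.1, ?_⟩) hn
  obtain ⟨i, hi⟩ := Option.ne_none_iff_exists'.1 hxy.2.2
  rw [hi]
  exact (ncard_cellOf_eq_some_le φ a i).trans <|
    (Nat.add_le_add_left (ha.card_le i) _).trans hcell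

open scoped Classical in
lemma card_mul_card_le_ncard_edgeSet_cellGraph [Finite V]
    (ha : IsAssignment (SeesCell G φ) s a) :
    #{v | a v ≠ none} * Fintype.card κ ≤ (cellGraph G φ a).edgeSet.ncard := by
  have hex (x : {v // a v ≠ none} × κ) : ∃ z : ι × κ × γ,
      a x.1 = some z.1 ∧ z.2.1 = x.2 ∧ G.Adj (φ (.inr x.1)) (φ (.inl z)) := by
    obtain ⟨i, hi⟩ := Option.ne_none_iff_exists'.1 x.1.2
    obtain ⟨l, hl⟩ := ha.rel hi x.2
    exact ⟨(i, x.2, l), hi, rfl, hl.symm⟩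
  choose g hcell hgroup hadj using hex
  calc #{v | a v ≠ none} * Fintype.card κ = Nat.card ({v // a v ≠ none} × κ) := by
        rw [Nat.card_prod, Nat.card_eq_fintype_card, Nat.card_eq_fintype_card, Fintype.card_subtype]
    _ ≤ Nat.card (cellGraph G φ a).edgeSet := by
        refine Nat.card_le_card_of_injective
          (fun x ↦ ⟨s(φ (.inr x.1), φ (.inl (g x))), hadj x, ?_, ?_⟩) fun x y hxy ↦ ?_
        · rw [cellOf_inr, cellOf_inl, hcell]
        · rw [cellOf_inr]
          exact x.1.2
        · replace hxy := congrArg Subtype.val hxy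
          simp only [Sym2.eq_iff, φ.injective.eq_iff, Sum.inr.injEq,
            Sum.inl.injEq, reduceCtorEq, false_and, or_false] at hxy
          refine Prod.ext (Subtype.ext hxy.1) ?_
          rw [← hgroup x, ← hgroup y, hxy.2]
    _ = (cellGraph G φ a).edgeSet.ncard := rfl

lemma card_mul_le_two_mul_exIn [Fintype ι] [Fintype V] [Fintype γ] (hn : 0 < n)
    (hcell : Fintype.card κ * Fintype.card γ + s ≤ n)
    (h : ∀ (J : Finset ι) (U : Finset β), Fintype.card ι ≤ 2 * #J →
      Fintype.card β ≤ #U + Fintype.card ι * s → ∃ i ∈ J, ∃ v ∈ U, SeesCell G φ i v) :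
    Fintype.card ι * s * Fintype.card κ ≤ 2 * G.exIn (pathGraph (n + 1)) := by
  classical
  obtain ⟨a, ha, hcard⟩ := exists_isAssignment h
  calc Fintype.card ι * s * Fintype.card κ ≤ 2 * #{v | a v ≠ none} * Fintype.card κ := by gcongr
    _ = 2 * (#{v | a v ≠ none} * Fintype.card κ) := mul_assoc _ _ _
    _ ≤ 2 * G.exIn (pathGraph (n + 1)) := by
        gcongr
        exact (card_mul_card_le_ncard_edgeSet_cellGraph G φ ha).trans <|
          ncard_edgeSet_le_exIn (fun _ _ h ↦ h.1) (pathGraph_free_cellGraph G φ ha hn hcell)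

end Cells

section LowerTail

variable {V W : Type*} [Fintype V] (p : I) {n : ℕ} {M ε : ℝ}

lemma measureReal_exIn_le_of_free {F : SimpleGraph W} {H : SimpleGraph V} (hH : F.Free H)
    (hM : 0 < M) (hMle : M ≤ H.edgeSet.ncard * (p : ℝ)) (hε : 0 < ε) (hε1 : ε ≤ 1) :
    (binomialRandom V p).real {G | (G.exIn F : ℝ) ≤ (1 - ε) * M} ≤ 1 / (ε ^ 2 * M) := by
  classical
  refine (measureReal_mono fun G hG ↦ ?_).trans (measureReal_card_hitEvent_le p H.edgeFinset
    (T := fun e ↦ {e}) (c := 1) (fun e he e' he' ↦ ?_) (fun _ _ ↦ Finset.card_singleton _)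
    (fun e _ e' _ hee' ↦ Finset.disjoint_singleton.2 hee') hM ?_ hε hε1)
  · rw [Set.mem_ofPred_eq] at hG ⊢
    refine hG.trans' ?_
    have hedges : ({e ∈ H.edgeFinset | G ∈ hitEvent {e}} : Finset (Sym2 V)) =
        (G ⊓ H).edgeFinset := by
      ext e
      simp [hitEvent, and_comm]
    rw [hedges, edgeFinset, ← Set.ncard_eq_toFinset_card']
    exact_mod_cast ncard_edgeSet_le_exIn inf_le_left fun h ↦ hH (h.mono_right inf_le_right)
  · rw [Finset.mem_singleton.1 he']
    exact H.not_isDiag_of_mem_edgeSet (mem_edgeFinset.1 he)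
  · rwa [pow_one, sub_sub_cancel, edgeFinset, ← Set.ncard_eq_toFinset_card']

lemma measureReal_exIn_pathGraph_le_of_stars (R : Finset V) (hn : 3 ≤ n) (hM : 0 < M)
    (hMle : M ≤ #R * (1 - (1 - p : ℝ) ^ (Fintype.card V - #R))) (hε : 0 < ε) (hε1 : ε ≤ 1) :
    (binomialRandom V p).real {G | (G.exIn (pathGraph (n + 1)) : ℝ) ≤ (1 - ε) * M} ≤
      1 / (ε ^ 2 * M) := by
  classical
  let T (v : V) : Finset (Sym2 V) := Rᶜ.image fun w ↦ s(v, w)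
  have hT {v : V} {e : Sym2 V} : e ∈ T v ↔ ∃ w ∉ R, s(v, w) = e := by simp [T]
  refine (measureReal_mono fun G hG ↦ ?_).trans (measureReal_card_hitEvent_le p R (T := T)
    (fun v hv e he ↦ ?_) (fun v _ ↦ ?_) (fun v hv v' _ hvv' ↦ ?_) hM hMle hε hε1)
  · rw [Set.mem_ofPred_eq] at hG ⊢
    refine hG.trans' ?_
    refine mod_cast (Finset.card_le_card fun v hv ↦ ?_).trans
      (card_filter_exists_adj_le_exIn G R hn)
    obtain ⟨hvR, e, he, heG⟩ := Finset.mem_filter.1 hv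
    obtain ⟨w, hw, rfl⟩ := hT.1 he
    exact Finset.mem_filter.2 ⟨hvR, w, hw, heG⟩
  · obtain ⟨w, hw, rfl⟩ := hT.1 he
    rw [Sym2.mk_isDiag_iff]
    exact ne_of_mem_of_not_mem hv hw
  · rw [Finset.card_image_of_injective _ fun a b h ↦ Sym2.congr_right.1 h, Finset.card_compl]
  · refine Finset.disjoint_left.2 fun e he he' ↦ ?_
    obtain ⟨w, -, rfl⟩ := hT.1 he
    obtain ⟨w', hw', h⟩ := hT.1 he'
    rcases Sym2.eq_iff.1 h with ⟨h, -⟩ | ⟨-, h⟩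
    · exact hvv' h.symm
    · exact hw' (h ▸ hv)

end LowerTail

section Blocks

variable {N n : ℕ}

/-- The disjoint union of complete graphs on consecutive blocks of `n` vertices, the last block
possibly being shorter. -/
def blockGraph (N n : ℕ) : SimpleGraph (Fin N) where
  Adj x y := x ≠ y ∧ x.val / n = y.val / n
  symm := ⟨fun _ _ h ↦ ⟨h.1.symm, h.2.symm⟩⟩
  loopless := ⟨fun _ h ↦ h.1 rfl⟩

lemma pathGraph_free_blockGraph (hn : 0 < n) : (pathGraph (n + 1)).Free (blockGraph N n) := by
  refine pathGraph_free_of_fibers (fun x : Fin N ↦ x.val / n) (fun x y hxy ↦ ⟨hxy.2, ?_⟩) hn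
  calc {z : Fin N | z.val / n = x.val / n}.ncard
      ≤ (Finset.Ico (x.val / n * n) (x.val / n * n + n) : Set ℕ).ncard := by
        refine Set.ncard_le_ncard_of_injOn Fin.val (fun z hz ↦ ?_) Fin.val_injective.injOn
        have := (Nat.div_eq_iff hn).1 hz
        rw [Finset.coe_Ico, Set.mem_Ico]
        omega
    _ = n := by rw [Set.ncard_coe_finset]; simp

lemma sub_one_le_degree_blockGraph [DecidableRel (blockGraph N n).Adj] (hn : 0 < n) {x : Fin N}
    (hx : x.val < N / n * n) : n - 1 ≤ (blockGraph N n).degree x := by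
  have hle : x.val / n * n + n ≤ N :=
    calc x.val / n * n + n = (x.val / n + 1) * n := by ring
      _ ≤ N / n * n := Nat.mul_le_mul_right n ((Nat.div_lt_iff_lt_mul hn).2 hx)
      _ ≤ N := Nat.div_mul_le_self N n
  let block : Fin n ↪ Fin N := ⟨fun j ↦ ⟨x.val / n * n + j, by omega⟩, fun a b hab ↦ by
    simpa [Fin.ext_iff] using hab⟩
  have hsub : (Finset.univ.map block).erase x ⊆ (blockGraph N n).neighborFinset x := by
    intro y hy
    obtain ⟨hyx, hy⟩ := Finset.mem_erase.1 hy
    obtain ⟨j, -, rfl⟩ := Finset.mem_map.1 hy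
    refine (mem_neighborFinset ..).2 ⟨hyx.symm, ?_⟩
    change x.val / n = (x.val / n * n + j) / n
    rw [mul_comm, Nat.mul_add_div hn, Nat.div_eq_of_lt j.2, add_zero]
  calc n - 1 = #(Finset.univ.map block) - 1 := by simp
    _ ≤ #((Finset.univ.map block).erase x) := Finset.pred_card_le_card_erase
    _ ≤ #((blockGraph N n).neighborFinset x) := Finset.card_le_card hsub
    _ = (blockGraph N n).degree x := card_neighborFinset_eq_degree ..

lemma sub_mul_sub_one_le_two_mul_ncard_edgeSet_blockGraph (hn : 0 < n) :
    (N - n) * (n - 1) ≤ 2 * (blockGraph N n).edgeSet.ncard := by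
  classical
  rw [Set.ncard_eq_toFinset_card', ← edgeFinset, ← sum_degrees_eq_twice_card_edges]
  set S : Finset (Fin N) := {x | x.val < N / n * n}
  have hS : N - n ≤ #S := by
    have hcard : #S = N / n * n := by
      rw [Fin.card_filter_val_lt]
      exact min_eq_right (Nat.div_mul_le_self N n)
    have := Nat.div_add_mod' N n
    have := Nat.mod_lt N hn
    omega
  calc (N - n) * (n - 1) ≤ #S * (n - 1) := by gcongr
    _ ≤ ∑ x ∈ S, (blockGraph N n).degree x := Finset.card_nsmul_le_sum _ _ _ fun x hx ↦
        sub_one_le_degree_blockGraph hn (Finset.mem_filter.1 hx).2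
    _ ≤ ∑ x, (blockGraph N n).degree x := Finset.sum_le_sum_of_subset (Finset.subset_univ _)

end Blocks

section CellsLowerTail

variable {V ι κ γ β : Type*}

open scoped Classical in
/-- The pairs joining the outer vertex `v` to the group `j` of the cell `i`. -/
noncomputable def cellPairs [Fintype γ] (φ : (ι × κ × γ) ⊕ β ↪ V) (i : ι) (v : β) (j : κ) :
    Finset (Sym2 V) :=
  Finset.univ.image fun l ↦ s(φ (.inl (i, j, l)), φ (.inr v))

variable (p : I) (φ : (ι × κ × γ) ⊕ β ↪ V) [Fintype γ]

lemma card_cellPairs (i : ι) (v : β) (j : κ) : #(cellPairs φ i v j) = Fintype.card γ := by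
  classical
  rw [cellPairs, Finset.card_image_of_injective _ fun a b h ↦ by simpa using h, Finset.card_univ]

lemma eq_of_mem_cellPairs {i i' : ι} {v v' : β} {j j' : κ} {e : Sym2 V}
    (h : e ∈ cellPairs φ i v j) (h' : e ∈ cellPairs φ i' v' j') : i = i' ∧ v = v' ∧ j = j' := by
  simp only [cellPairs, Finset.mem_image, Finset.mem_univ, true_and] at h h'
  obtain ⟨l, rfl⟩ := h
  obtain ⟨l', h'⟩ := h'
  simp only [Sym2.eq_iff, φ.injective.eq_iff, Sum.inr.injEq, Sum.inl.injEq, reduceCtorEq,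
    false_and, or_false, Prod.mk.injEq] at h'
  exact ⟨h'.1.1.symm, h'.2.symm, h'.1.2.1.symm⟩

lemma not_isDiag_of_mem_cellPairs {i : ι} {v : β} {j : κ} {e : Sym2 V}
    (h : e ∈ cellPairs φ i v j) : ¬ e.IsDiag := by
  simp only [cellPairs, Finset.mem_image, Finset.mem_univ, true_and] at h
  obtain ⟨l, rfl⟩ := h
  simp

lemma setOf_seesCell_eq (i : ι) (v : β) :
    {G : SimpleGraph V | SeesCell G φ i v} =
      ⋂ j, hitEvent (cellPairs φ i v j) := by
  ext G
  simp [SeesCell, cellPairs, hitEvent]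

lemma measurableSet_pairAlgebra_seesCell [Finite κ] (i : ι) (v : β) :
    MeasurableSet[pairAlgebra (⋃ j, (cellPairs φ i v j : Set (Sym2 V)))]
      {G : SimpleGraph V | SeesCell G φ i v} := by
  rw [setOf_seesCell_eq]
  exact MeasurableSet.iInter fun j ↦
    pairAlgebra_mono (Set.subset_iUnion (fun j ↦ (cellPairs φ i v j : Set (Sym2 V))) j) _
      (measurableSet_pairAlgebra_hitEvent _)

variable [Fintype κ]

lemma measureReal_seesCell [Finite V] (i : ι) (v : β) :
    (binomialRandom V p).real {G | SeesCell G φ i v} =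
      (1 - (1 - p : ℝ) ^ Fintype.card γ) ^ Fintype.card κ := by
  have hprod := measureReal_biInter_of_pairAlgebra p Finset.univ
    (S := fun j ↦ (cellPairs φ i v j : Set (Sym2 V)))
    (fun j _ j' _ hj ↦ Set.disjoint_left.2 fun e he he' ↦
      hj (eq_of_mem_cellPairs φ he he').2.2)
    fun j _ ↦ measurableSet_pairAlgebra_hitEvent _
  have hhit (j : κ) : (binomialRandom V p).real (hitEvent (cellPairs φ i v j)) =
      1 - (1 - p : ℝ) ^ Fintype.card γ := by
    rw [measureReal_hitEvent p fun e he ↦ not_isDiag_of_mem_cellPairs φ he, card_cellPairs]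
  simp only [Finset.mem_univ, Set.iInter_true, hhit, Finset.prod_const, Finset.card_univ] at hprod
  rw [setOf_seesCell_eq, hprod]

lemma measureReal_forall_not_seesCell [Finite V] (J : Finset ι) (U : Finset β) :
    (binomialRandom V p).real {G | ∀ i ∈ J, ∀ v ∈ U, ¬ SeesCell G φ i v} =
      (1 - (1 - (1 - p : ℝ) ^ Fintype.card γ) ^ Fintype.card κ) ^ (#J * #U) := by
  have hinter : {G : SimpleGraph V | ∀ i ∈ J, ∀ v ∈ U, ¬ SeesCell G φ i v} =
      ⋂ z ∈ J ×ˢ U, {G | SeesCell G φ z.1 z.2}ᶜ := by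
    ext G
    simp only [Set.mem_ofPred_eq, Set.mem_iInter, Finset.mem_product, Set.mem_compl_iff,
      Prod.forall]
    tauto
  have hcompl (z : ι × β) : (binomialRandom V p).real {G | SeesCell G φ z.1 z.2}ᶜ =
      1 - (1 - (1 - p : ℝ) ^ Fintype.card γ) ^ Fintype.card κ := by
    rw [probReal_compl_eq_one_sub MeasurableSet.of_discrete, measureReal_seesCell]
  rw [hinter, measureReal_biInter_of_pairAlgebra p (J ×ˢ U)
    (S := fun z ↦ ⋃ j, (cellPairs φ z.1 z.2 j : Set (Sym2 V))) (fun z _ z' _ hz ↦ ?_)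
    fun z _ ↦ (measurableSet_pairAlgebra_seesCell φ z.1 z.2).compl]
  · simp only [hcompl, Finset.prod_const, Finset.card_product]
  · refine Set.disjoint_left.2 fun e he he' ↦ hz ?_
    obtain ⟨j, hj⟩ := Set.mem_iUnion.1 he
    obtain ⟨j', hj'⟩ := Set.mem_iUnion.1 he'
    obtain ⟨hi, hv, -⟩ := eq_of_mem_cellPairs φ hj hj'
    exact Prod.ext hi hv

lemma measureReal_forall_not_seesCell_le [Finite V] (J : Finset ι) (U : Finset β) {q : ℝ}
    (hq : q ≤ (1 - (1 - p : ℝ) ^ Fintype.card γ) ^ Fintype.card κ) :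
    (binomialRandom V p).real {G | ∀ i ∈ J, ∀ v ∈ U, ¬ SeesCell G φ i v} ≤
      Real.exp (-(q * (#J * #U))) := by
  rw [measureReal_forall_not_seesCell]
  have hmiss : (1 - p : ℝ) ^ Fintype.card γ ∈ Set.Icc 0 1 :=
    ⟨pow_nonneg (sub_nonneg.2 p.2.2) _, pow_le_one₀ (sub_nonneg.2 p.2.2) (sub_le_self _ p.2.1)⟩
  have hle : (1 - (1 - p : ℝ) ^ Fintype.card γ) ^ Fintype.card κ ≤ 1 :=
    pow_le_one₀ (sub_nonneg.2 hmiss.2) (sub_le_self _ hmiss.1)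
  calc (1 - (1 - (1 - p : ℝ) ^ Fintype.card γ) ^ Fintype.card κ) ^ (#J * #U)
      ≤ Real.exp (-q) ^ (#J * #U) := by
        refine pow_le_pow_left₀ (sub_nonneg.2 hle) ?_ _
        linarith [Real.add_one_le_exp (-q)]
    _ = Real.exp (-(q * (#J * #U))) := by
        rw [← Real.exp_nat_mul]
        push_cast
        ring_nf

lemma measureReal_exIn_pathGraph_lt_of_cells [Fintype V] [Fintype ι] [Fintype β]
    (φ : (ι × κ × γ) ⊕ β ↪ V) {n s : ℕ}
    (hn : 0 < n) (hcell : Fintype.card κ * Fintype.card γ + s ≤ n) {q u : ℝ} (hq0 : 0 ≤ q)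
    (hq : q ≤ (1 - (1 - p : ℝ) ^ Fintype.card γ) ^ Fintype.card κ) (hu0 : 0 ≤ u)
    (hu : u + Fintype.card ι * s ≤ Fintype.card β) :
    (binomialRandom V p).real {G | 2 * (G.exIn (pathGraph (n + 1)) : ℝ) <
      Fintype.card ι * s * Fintype.card κ} ≤
      2 ^ (Fintype.card ι + Fintype.card β) *
        Real.exp (-(q * (Fintype.card ι / 2 * u))) := by
  classical
  set Q : Finset (Finset ι × Finset β) := {z | Fintype.card ι ≤ 2 * #z.1 ∧
    Fintype.card β ≤ #z.2 + Fintype.card ι * s}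
  have hsub : {G : SimpleGraph V | 2 * (G.exIn (pathGraph (n + 1)) : ℝ) <
      Fintype.card ι * s * Fintype.card κ} ⊆
      ⋃ z ∈ Q, {G | ∀ i ∈ z.1, ∀ v ∈ z.2, ¬ SeesCell G φ i v} := by
    intro G hG
    contrapose! hG
    simp only [Set.mem_iUnion, not_exists] at hG
    rw [Set.mem_ofPred_eq, not_lt]
    exact_mod_cast card_mul_le_two_mul_exIn G φ hn hcell fun J U hJ hU ↦ by
      simpa using hG (J, U) (by simp [Q, hJ, hU])
  have hterm : ∀ z ∈ Q, (binomialRandom V p).real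
      {G | ∀ i ∈ z.1, ∀ v ∈ z.2, ¬ SeesCell G φ i v} ≤
      Real.exp (-(q * (Fintype.card ι / 2 * u))) := fun z hz ↦ by
    obtain ⟨hJ, hU⟩ := (Finset.mem_filter.1 hz).2
    have hJ' : (Fintype.card ι : ℝ) ≤ 2 * #z.1 := by exact_mod_cast hJ
    have hU' : (Fintype.card β : ℝ) ≤ #z.2 + Fintype.card ι * s := by exact_mod_cast hU
    refine (measureReal_forall_not_seesCell_le p φ z.1 z.2 hq).trans ?_
    gcongr <;> linarith
  have hQ : #Q ≤ 2 ^ (Fintype.card ι + Fintype.card β) :=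
    (Finset.card_le_univ Q).trans_eq (by simp [pow_add])
  calc _ ≤ _ := measureReal_mono hsub (measure_ne_top _ _)
    _ ≤ ∑ z ∈ Q, (binomialRandom V p).real {G | ∀ i ∈ z.1, ∀ v ∈ z.2, ¬ SeesCell G φ i v} :=
        measureReal_biUnion_finset_le _ _
    _ ≤ #Q * Real.exp (-(q * (Fintype.card ι / 2 * u))) := by
        simpa using Finset.sum_le_card_nsmul _ _ _ hterm
    _ ≤ _ := by
        gcongr
        exact_mod_cast hQ

end CellsLowerTail

section Estimates

variable {n N : ℕ} {p : I}

lemma one_le_log {x : ℝ} (hx : 3 ≤ x) : 1 ≤ Real.log x := by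
  rw [Real.le_log_iff_exp_le (by linarith)]
  linarith [Real.exp_one_lt_d9]

lemma log_le_mul_self {x : ℝ} (hx : 0 < x) : Real.log x ≤ 0.37 * x := by
  have hlog := Real.log_le_sub_one_of_pos (show 0 < x / Real.exp 1 by positivity)
  rw [Real.log_div hx.ne' (Real.exp_pos 1).ne', Real.log_exp] at hlog
  have hdiv : x / Real.exp 1 ≤ 0.37 * x := by
    rw [div_le_iff₀ (Real.exp_pos 1)]
    nlinarith [Real.exp_one_gt_d9]
  linarith

lemma exp_neg_le_inv (hn : 0 < n) : Real.exp (-n) ≤ 1 / n := by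
  rw [Real.exp_neg, ← one_div]
  gcongr
  linarith [Real.add_one_le_exp (n : ℝ)]

lemma div_one_add_le_one_sub_pow {x : ℝ} (hx0 : 0 ≤ x) (hx1 : x ≤ 1) (k : ℕ) :
    k * x / (1 + k * x) ≤ 1 - (1 - x) ^ k := by
  have hbernoulli : 1 + k * x ≤ (1 + x) ^ k := one_add_mul_le_pow (by linarith) k
  have hprod : (1 - x) ^ k * (1 + x) ^ k ≤ 1 := by
    rw [← mul_pow]
    exact pow_le_one₀ (by nlinarith) (by nlinarith)
  have hpow : (0 : ℝ) ≤ (1 - x) ^ k := pow_nonneg (by linarith) k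
  rw [div_le_iff₀ (by positivity)]
  nlinarith [mul_le_mul_of_nonneg_left hbernoulli hpow]

lemma measureReal_lt_exIn_le_exp_neg_of_le_eight_mul {W : Type*} (F : SimpleGraph W)
    (hN : 3 * (n : ℝ) ≤ N) (hN8 : (N : ℝ) ≤ 8 * n) (hp : 1 ≤ 6 * ((p : ℝ) * n)) :
    (binomialRandom (Fin N) p).real {G | 18 * ((p : ℝ) * n * N) < (G.exIn F : ℝ)} ≤
      Real.exp (-n) := by
  have hp0 : (0 : ℝ) ≤ p := p.2.1
  have hlog4 : Real.log 4 = 2 * Real.log 2 := by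
    rw [show (4 : ℝ) = 2 ^ 2 by norm_num, Real.log_pow, Nat.cast_ofNat]
  have hlog2 := Real.log_two_gt_d9
  refine (measureReal_lt_exIn_le p F (τ := 18 * (p * n * N)) (c := Real.log 4)
    (by positivity) (by linarith) ?_).trans (Real.exp_le_exp.2 ?_)
  · rw [Real.exp_neg, Real.exp_log (by norm_num), Fintype.card_fin]
    have : 0 ≤ (p : ℝ) * N := by positivity
    nlinarith
  · have hτ : 3 * (N : ℝ) ≤ 18 * (p * n * N) := by nlinarith
    rw [hlog4]
    nlinarith

lemma measureReal_lt_exIn_pathGraph_le_exp_neg_of_eight_mul_le (hn : 0 < n)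
    (hN : 8 * (n : ℝ) ≤ N) (hp : Real.log (N / n) ≤ 6 * ((p : ℝ) * n)) :
    (binomialRandom (Fin N) p).real
      {G | 18 * ((p : ℝ) * n * N) < (G.exIn (pathGraph (n + 1)) : ℝ)} ≤ Real.exp (-n) := by
  have hn' : (0 : ℝ) < n := by exact_mod_cast hn
  have hN' : (0 : ℝ) < N := by linarith
  have hp0 : (0 : ℝ) ≤ p := p.2.1
  have hlog8 : Real.log 8 = 3 * Real.log 2 := by
    rw [show (8 : ℝ) = 2 ^ 3 by norm_num, Real.log_pow, Nat.cast_ofNat]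
  have hlog2 := Real.log_two_gt_d9
  have hdiv : 8 ≤ (N : ℝ) / n := (le_div_iff₀ hn').2 hN
  refine (measureReal_lt_exIn_pathGraph_le p hn (τ := 16 * (p * n) * n) (c := Real.log 8) ?_
    (by positivity) (by linarith) ?_ ?_).trans (Real.exp_le_exp.2 ?_)
  · rw [Fintype.card_fin]
    exact_mod_cast (by linarith : (2 : ℝ) * n ≤ N)
  · rw [Real.exp_neg, Real.exp_log (by norm_num)]
    linarith
  · have hτ : ((N : ℝ) / n + 1) * (16 * (p * n) * n) = p * n * (16 * (N + n)) := by
      field_simp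
    rw [Fintype.card_fin, hτ]
    have : 0 ≤ (p : ℝ) * n := by positivity
    nlinarith
  · rw [Fintype.card_fin, mul_comm 2 (n : ℝ), ← div_div,
      Real.log_div (by positivity) two_ne_zero, hlog8]
    set L := Real.log ((N : ℝ) / n)
    have hL : 2 ≤ L := by linarith [Real.log_le_log (by norm_num) hdiv]
    have hτ : 16 / 6 * L * n ≤ 16 * (p * n) * n := by nlinarith
    calc n * 2 * (L - Real.log 2 + 1) +
          (16 * (p * n) * n - 3 * Real.log 2 * (16 * (p * n) * n))
        = n * 2 * (L + (1 - Real.log 2)) - (3 * Real.log 2 - 1) * (16 * (p * n) * n) := by ring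
      _ ≤ n * 2 * (L + 0.31) - 1.07 * (16 / 6 * L * n) := by gcongr <;> linarith
      _ ≤ -n := by nlinarith

lemma measureReal_lt_exIn_pathGraph_le_of_dense (hn : 0 < n) (hN : 3 * (n : ℝ) ≤ N)
    (hp : Real.log ((N : ℝ) / n) / (6 * n) ≤ p) :
    (binomialRandom (Fin N) p).real
      {G | 18 * ((p : ℝ) * n * N) < (G.exIn (pathGraph (n + 1)) : ℝ)} ≤ Real.exp (-n) := by
  have hn' : (0 : ℝ) < n := by exact_mod_cast hn
  have hL : 1 ≤ Real.log ((N : ℝ) / n) := one_le_log ((le_div_iff₀ hn').2 hN)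
  rw [div_le_iff₀ (by positivity)] at hp
  rcases le_total (N : ℝ) (8 * n) with hN8 | hN8
  · exact measureReal_lt_exIn_le_exp_neg_of_le_eight_mul _ hN hN8 (by linarith)
  · exact measureReal_lt_exIn_pathGraph_le_exp_neg_of_eight_mul_le hn hN8 (by linarith)

/- With `L = log (N / n)`, the threshold is `τ = 6nL / log ω`; it exceeds the expected number of
pairs in a set of `2n` vertices by the factor `3ω / log ω`, whose logarithm is of order `log ω`. -/
lemma measureReal_lt_exIn_pathGraph_le_of_sparse (hn : 0 < n) (hN : 3 * (n : ℝ) ≤ N) {ω : ℝ}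
    (hω : 1 < ω) (hL : Real.log ((N : ℝ) / n) = ω * (n * p)) :
    (binomialRandom (Fin N) p).real
      {G | 8 * (ω / Real.log ω) * ((p : ℝ) * n * N) < (G.exIn (pathGraph (n + 1)) : ℝ)} ≤
      Real.exp (-n) := by
  have hn' : (0 : ℝ) < n := by exact_mod_cast hn
  have hN' : (0 : ℝ) < N := by linarith
  have hL1 : 1 ≤ Real.log ((N : ℝ) / n) := one_le_log ((le_div_iff₀ hn').2 hN)
  set L := Real.log ((N : ℝ) / n)
  set x := Real.log ω
  have hx : 0 < x := Real.log_pos hω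
  have hc : 1 + 0.63 * x ≤ Real.log (3 * ω / x) := by
    rw [Real.log_div (by positivity) hx.ne', Real.log_mul (by norm_num) (by positivity)]
    linarith [log_le_mul_self hx, Real.log_three_gt_d9]
  refine (measureReal_lt_exIn_pathGraph_le p hn (τ := 6 * n * L / x) (c := Real.log (3 * ω / x))
    ?_ (by positivity) (by linarith) ?_ ?_).trans (Real.exp_le_exp.2 ?_)
  · rw [Fintype.card_fin]
    exact_mod_cast (by linarith : (2 : ℝ) * n ≤ N)
  · rw [Real.exp_neg, Real.exp_log (by positivity), hL]
    refine le_of_eq ?_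
    field_simp
    ring
  · have hτ : ((N : ℝ) / n + 1) * (6 * n * L / x) = 6 * (N + n) * L / x := by field_simp
    have hX : 8 * (ω / x) * (p * n * N) = 8 * N * L / x := by rw [hL]; field_simp
    rw [Fintype.card_fin, hτ, hX]
    gcongr ?_ * L / x
    linarith
  · rw [Fintype.card_fin, mul_comm 2 (n : ℝ), ← div_div,
      Real.log_div (by positivity) two_ne_zero]
    calc n * 2 * (L - Real.log 2 + 1) + (6 * n * L / x - Real.log (3 * ω / x) * (6 * n * L / x))
        = n * 2 * (L + (1 - Real.log 2)) - (Real.log (3 * ω / x) - 1) * (6 * n * L / x) := by ring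
      _ ≤ n * 2 * (L + 0.31) - 0.63 * x * (6 * n * L / x) := by
          gcongr <;> linarith [Real.log_two_gt_d9]
      _ = n * 2 * (L + 0.31) - 3.78 * (n * L) := by field_simp; ring
      _ ≤ -n := by nlinarith

lemma measureReal_exIn_pathGraph_lt_le_of_dense (hn : 100 ≤ n) (hN : 3 * (n : ℝ) ≤ N)
    (hp : Real.log ((N : ℝ) / n) / (6 * n) ≤ p) :
    (binomialRandom (Fin N) p).real
      {G | (G.exIn (pathGraph (n + 1)) : ℝ) < 1 / 4 * ((p : ℝ) * n * N)} ≤ 1000 / n := by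
  have hn100 : (100 : ℝ) ≤ n := by exact_mod_cast hn
  have hn' : (0 : ℝ) < n := by linarith
  have hN' : n ≤ N := by exact_mod_cast (by linarith : (n : ℝ) ≤ N)
  have hp0 : (0 : ℝ) ≤ p := p.2.1
  have hL : 1 ≤ Real.log ((N : ℝ) / n) := one_le_log ((le_div_iff₀ hn').2 hN)
  rw [div_le_iff₀ (by positivity)] at hp
  have hpnN : (n : ℝ) / 2 ≤ p * n * N := by nlinarith
  have hedges : 0.33 * ((n : ℝ) * N) ≤ (blockGraph N n).edgeSet.ncard := by
    have hblocks : ((N : ℝ) - n) * (n - 1) ≤ 2 * (blockGraph N n).edgeSet.ncard := by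
      have := sub_mul_sub_one_le_two_mul_ncard_edgeSet_blockGraph (N := N) (by omega : 0 < n)
      rw [← Nat.cast_sub hN', ← Nat.cast_pred (by omega : 0 < n)]
      exact_mod_cast this
    nlinarith [mul_nonneg (sub_nonneg.2 hN) (sub_nonneg.2 hn100)]
  refine (measureReal_mono fun G hG ↦ ?_).trans
    ((measureReal_exIn_le_of_free p (pathGraph_free_blockGraph (by omega))
      (M := 0.33 * (p * n * N)) (ε := 8 / 33) (by linarith) (by nlinarith) (by norm_num)
      (by norm_num)).trans ?_)
  · rw [Set.mem_ofPred_eq] at hG ⊢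
    linarith
  · rw [div_le_div_iff₀ (mul_pos (by norm_num) (by linarith)) hn']
    linarith

lemma measureReal_exIn_pathGraph_lt_le_of_inv_le (hn : 100 ≤ n) (hN : n ≤ N)
    (hp : (N : ℝ)⁻¹ ≤ p) : (binomialRandom (Fin N) p).real
      {G | (G.exIn (pathGraph (n + 1)) : ℝ) < 10 / 75 * N} ≤ 1000 / n := by
  have hn' : (0 : ℝ) < n := by exact_mod_cast (by omega : 0 < n)
  have hnN : (n : ℝ) ≤ N := by exact_mod_cast hN
  have hN100 : (100 : ℝ) ≤ N := by exact_mod_cast hn.trans hN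
  have hN' : (0 : ℝ) < N := by linarith
  obtain ⟨R, -, hR⟩ := Finset.exists_subset_card_eq
    (show N - N / 2 ≤ #(Finset.univ : Finset (Fin N)) by simp)
  have hRc : Fintype.card (Fin N) - #R = N / 2 := by
    rw [Fintype.card_fin, hR, Nat.sub_sub_self (N.div_le_self 2)]
  have hR2 : (N : ℝ) / 2 ≤ #R := by
    rw [div_le_iff₀ two_pos]
    exact_mod_cast (by omega : N ≤ #R * 2)
  have hmean : 0.49 ≤ (N / 2 : ℕ) * (p : ℝ) :=
    calc (0.49 : ℝ) ≤ (N / 2 : ℕ) * (N : ℝ)⁻¹ := by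
          have : (N : ℝ) ≤ 2 * (N / 2 : ℕ) + 1 := by
            exact_mod_cast (by omega : N ≤ 2 * (N / 2) + 1)
          rw [← div_eq_mul_inv, le_div_iff₀ hN']
          linarith
      _ ≤ (N / 2 : ℕ) * (p : ℝ) := by gcongr
  have hhit : 0.32 ≤ 1 - (1 - p : ℝ) ^ (N / 2) := by
    refine le_trans ?_ (div_one_add_le_one_sub_pow p.2.1 p.2.2 _)
    rw [le_div_iff₀ (by linarith)]
    linarith
  refine (measureReal_mono fun G hG ↦ ?_).trans
    ((measureReal_exIn_pathGraph_le_of_stars p R (n := n) (by omega) (M := 0.16 * N) (ε := 1 / 6)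
      (by linarith) ?_ (by norm_num) (by norm_num)).trans ?_)
  · rw [Set.mem_ofPred_eq] at hG ⊢
    linarith
  · rw [hRc]
    nlinarith
  · rw [div_le_div_iff₀ (by positivity) hn']
    linarith

lemma inv_le_one_sub_pow {ω x : ℝ} (hx0 : 0 ≤ x) (hx1 : x ≤ 1) {k : ℕ} (hω : 6 ≤ ω)
    (hk : 1.5 ≤ ω * (k * x)) : ω⁻¹ ≤ 1 - (1 - x) ^ k := by
  refine le_trans ?_ (div_one_add_le_one_sub_pow hx0 hx1 k)
  have : 0 ≤ k * x := by positivity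
  rw [inv_eq_one_div, div_le_div_iff₀ (by linarith) (by linarith)]
  nlinarith

lemma mul_le_cast_div_two_mul (hn : 0 < n) (hN : 1000 * (n : ℝ) ≤ N) :
    0.499 * ((N : ℝ) / n) ≤ (N / (2 * n) : ℕ) := by
  have hn' : (0 : ℝ) < n := by exact_mod_cast hn
  have hlt : (N : ℝ) ≤ ((N / (2 * n) : ℕ) + 1) * (2 * n) := by
    exact_mod_cast ((Nat.lt_mul_div_succ N (by omega : 0 < 2 * n)).trans_eq (mul_comm _ _)).le
  rw [mul_div_assoc', div_le_iff₀ hn']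
  linarith

lemma mul_le_cast_div_two_mul_mul (hn : 100 ≤ n) (hN : 1000 * (n : ℝ) ≤ N) :
    0.247 * (N : ℝ) ≤ (N / (2 * n) : ℕ) * (n / 2 : ℕ) := by
  have hn' : (100 : ℝ) ≤ n := by exact_mod_cast hn
  have hhalf : (n : ℝ) ≤ 2 * (n / 2 : ℕ) + 1 := by
    exact_mod_cast (by omega : n ≤ 2 * (n / 2) + 1)
  calc 0.247 * (N : ℝ) ≤ 0.499 * (N / n) * (0.495 * n) := by field_simp; linarith
    _ ≤ (N / (2 * n) : ℕ) * (n / 2 : ℕ) := by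
        gcongr
        · exact mul_le_cast_div_two_mul (by omega) hN
        · linarith

lemma two_pow_mul_exp_neg_le {a m : ℕ} (ha : a ≤ N) {q : ℝ} (hq : 20 ≤ q * m) :
    2 ^ a * Real.exp (-(q * (m / 2 * (N / 5)))) ≤ Real.exp (-N) := by
  have hexp := Real.exp_one_gt_d9
  calc 2 ^ a * Real.exp (-(q * (m / 2 * (N / 5))))
      = 2 ^ a * Real.exp (-(q * m * (N / 10))) := by ring_nf
    _ ≤ Real.exp 1 ^ a * Real.exp (-(20 * (N / 10))) := by gcongr; linarith
    _ ≤ Real.exp 1 ^ N * Real.exp (-(20 * (N / 10))) := by gcongr; linarith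
    _ = Real.exp (-N) := by
        rw [← Real.exp_nat_mul, ← Real.exp_add]
        ring_nf

lemma measureReal_exIn_pathGraph_lt_le_of_cell_sizes (hn : 100 ≤ n) (hN : 1000 * (n : ℝ) ≤ N)
    {d k : ℕ} (hdk : 2 * d * k ≤ n) {q t : ℝ} (hq0 : 0 ≤ q)
    (hq : q ≤ (1 - (1 - p : ℝ) ^ k) ^ d) (hqm : 20 ≤ q * (N / (2 * n) : ℕ)) (hd : t / 8 ≤ d) :
    (binomialRandom (Fin N) p).real
      {G | (G.exIn (pathGraph (n + 1)) : ℝ) < 1 / 75 * (t * N)} ≤ Real.exp (-n) := by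
  have hn' : (100 : ℝ) ≤ n := by exact_mod_cast hn
  have hN' : (0 : ℝ) < N := by linarith
  have hedges := mul_le_cast_div_two_mul_mul hn hN
  have hmn : 2 * (N / (2 * n) * n) ≤ N := by linarith [Nat.div_mul_le_self N (2 * n)]
  set m := N / (2 * n)
  have hinner : m * (d * k) + N / 2 ≤ N := by
    have := Nat.mul_le_mul_left m hdk
    have : 2 * (2 * (m * (d * k))) ≤ N := by linarith
    omega
  have houter : (N : ℝ) / 5 + m * (n / 2 : ℕ) ≤ (N / 2 : ℕ) := by
    have hquarter : 4 * ((m : ℝ) * (n / 2 : ℕ)) ≤ N := by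
      have := Nat.mul_le_mul_left m (Nat.div_mul_le_self n 2)
      exact_mod_cast (by linarith : 4 * (m * (n / 2)) ≤ N)
    have hhalf : (N : ℝ) ≤ 2 * (N / 2 : ℕ) + 1 := by
      exact_mod_cast (by omega : N ≤ 2 * (N / 2) + 1)
    linarith
  obtain ⟨φ⟩ : Nonempty ((Fin m × Fin d × Fin k) ⊕ Fin (N / 2) ↪ Fin N) :=
    Function.Embedding.nonempty_of_card_le (by simpa using hinner)
  have hcells := measureReal_exIn_pathGraph_lt_of_cells p φ (n := n) (s := n / 2) (q := q)
    (u := N / 5)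
  simp only [Fintype.card_fin] at hcells
  have hcell : d * k + n / 2 ≤ n := by
    have : 2 * (d * k) ≤ n := by linarith
    omega
  refine (measureReal_mono fun G hG ↦ ?_).trans
    ((hcells (by omega) hcell hq0 hq (by positivity) houter).trans
      ((two_pow_mul_exp_neg_le ?_ hqm).trans ?_))
  · rw [Set.mem_ofPred_eq] at hG ⊢
    have : 0.247 * (N : ℝ) * (t / 8) ≤ m * (n / 2 : ℕ) * d :=
      (mul_le_mul_of_nonneg_left hd (by positivity)).trans (by gcongr)
    linarith
  · have : m * 1 ≤ m * n := Nat.mul_le_mul_left m (by omega)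
    omega
  · gcongr
    exact_mod_cast (by linarith : (n : ℝ) ≤ N)

lemma exists_cell_sizes (hn : 100 ≤ n) {t : ℝ} (ht : 10 ≤ t) (htn : t ≤ 3.9 * n) :
    ∃ d k : ℕ, 2 * d * k ≤ n ∧ n ≤ 4 * d * k ∧ t / 8 ≤ d ∧ d ≤ 0.225 * t := by
  have hn' : (100 : ℝ) ≤ n := by exact_mod_cast hn
  have hceil := Nat.ceil_lt_add_one (show 0 ≤ t / 8 by linarith)
  set d := ⌈t / 8⌉₊
  have hd : 0 < d := Nat.ceil_pos.2 (by linarith)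
  have hdn : 2 * d ≤ n := by exact_mod_cast (by linarith : 2 * (d : ℝ) ≤ n)
  refine ⟨d, n / (2 * d), Nat.mul_div_le _ _, ?_, Nat.le_ceil _, by linarith⟩
  have hk : 1 ≤ n / (2 * d) := (Nat.one_le_div_iff (by omega)).2 hdn
  have hlt : n < 2 * d * (n / (2 * d) + 1) := Nat.lt_mul_div_succ n (by omega)
  nlinarith

lemma thousand_mul_le (hn : 0 < n) (hL : 10 ≤ Real.log ((N : ℝ) / n)) :
    1000 * (n : ℝ) ≤ N := by
  have hn' : (0 : ℝ) < n := by exact_mod_cast hn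
  have hN : (0 : ℝ) < N / n :=
    (by positivity : (0 : ℝ) ≤ N / n).lt_of_ne fun h ↦ by rw [← h, Real.log_zero] at hL; linarith
  rw [← le_div_iff₀ hn']
  calc (1000 : ℝ) ≤ 2.7 ^ 10 := by norm_num
    _ ≤ Real.exp 1 ^ 10 := by gcongr; linarith [Real.exp_one_gt_d9]
    _ = Real.exp 10 := by rw [← Real.exp_nat_mul]; norm_num
    _ ≤ N / n := (Real.le_log_iff_exp_le hN).1 hL

lemma twenty_le_inv_pow_mul (hn : 0 < n) (hL : 10 ≤ Real.log ((N : ℝ) / n)) {ω : ℝ} {d : ℕ}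
    (hω : 0 < ω) (hd : d * Real.log ω ≤ 0.3 * Real.log ((N : ℝ) / n)) :
    20 ≤ ω⁻¹ ^ d * (N / (2 * n) : ℕ) := by
  have hN := thousand_mul_le hn hL
  have hn' : (0 : ℝ) < n := by exact_mod_cast hn
  have hN' : (0 : ℝ) < N := by linarith
  calc (20 : ℝ) ≤ 0.499 * 2.7 ^ 7 := by norm_num
    _ ≤ 0.499 * Real.exp 1 ^ 7 := by gcongr; linarith [Real.exp_one_gt_d9]
    _ = 0.499 * Real.exp 7 := by rw [← Real.exp_nat_mul]; norm_num
    _ ≤ 0.499 * Real.exp (-(d * Real.log ω) + Real.log (N / n)) := by gcongr; linarith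
    _ = ω⁻¹ ^ d * (0.499 * (N / n)) := by
        rw [Real.exp_add, Real.exp_log (by positivity), Real.exp_neg, Real.exp_nat_mul,
          Real.exp_log hω, inv_pow]
        ring
    _ ≤ ω⁻¹ ^ d * (N / (2 * n) : ℕ) := by
        gcongr
        exact mul_le_cast_div_two_mul hn hN

/- Cells of `d ≈ log (N / n) / (8 log ω)` groups of `k ≈ n / (2d)` vertices: a group is hit with
probability at least `1 / ω`, so a cell is seen by a given vertex with probability at least
`ω⁻ᵈ ≥ (N / n) ^ (-0.3)`. -/
lemma measureReal_exIn_pathGraph_lt_le_of_log_lt (hn : 100 ≤ n)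
    (hN : (N : ℝ) ≤ n * Real.exp (6 * n)) {ω : ℝ} (hω : 6 ≤ ω)
    (hL : Real.log ((N : ℝ) / n) = ω * (n * p))
    (hLω : 10 * Real.log ω < Real.log ((N : ℝ) / n)) : (binomialRandom (Fin N) p).real
      {G | (G.exIn (pathGraph (n + 1)) : ℝ) < 1 / 75 * (ω / Real.log ω) * ((p : ℝ) * n * N)} ≤
      Real.exp (-n) := by
  have hn' : (0 : ℝ) < n := by exact_mod_cast (by omega : 0 < n)
  have hp0 : (0 : ℝ) ≤ p := p.2.1
  have hx : 1.79 ≤ Real.log ω := by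
    have hlog6 : Real.log 6 = Real.log 2 + Real.log 3 := by
      rw [← Real.log_mul two_ne_zero three_ne_zero]; norm_num
    linarith [Real.log_le_log (by norm_num) hω, Real.log_two_gt_d9, Real.log_three_gt_d9]
  have hL10 : 10 ≤ Real.log ((N : ℝ) / n) := by linarith
  have hN1000 := thousand_mul_le (by omega) hL10
  have hLn : Real.log ((N : ℝ) / n) ≤ 6 * n := by
    rw [Real.log_le_iff_le_exp (div_pos (by linarith) hn'), div_le_iff₀' hn']
    exact hN
  have hvalue : ω / Real.log ω * (p * n * N) = Real.log ((N : ℝ) / n) / Real.log ω * N := by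
    rw [hL]; ring
  rw [mul_assoc, hvalue]
  set L := Real.log ((N : ℝ) / n)
  set x := Real.log ω
  have htx : L / x * x = L := div_mul_cancel₀ _ (by linarith)
  obtain ⟨d, k, hdk, hnk, hd, hd'⟩ := exists_cell_sizes hn (t := L / x)
    ((le_div_iff₀ (by linarith)).2 hLω.le) ((div_le_iff₀ (by linarith)).2 (by nlinarith))
  have hdx : d * x ≤ 0.225 * L := by nlinarith
  have hgroup : 1.5 ≤ ω * (k * p) := by
    have hLdk : L ≤ 4 * d * (ω * (k * p)) := by
      have : ω * p * n ≤ ω * p * (4 * d * k) := by gcongr; exact_mod_cast hnk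
      linarith
    by_contra! hlt
    have h4d : 4 * d * (ω * (k * p)) ≤ 4 * d * 1.5 := by gcongr
    have hd179 : (d : ℝ) * 1.79 ≤ d * x := by gcongr
    linarith
  have hhit := inv_le_one_sub_pow hp0 p.2.2 hω hgroup
  exact measureReal_exIn_pathGraph_lt_le_of_cell_sizes hn hN1000 hdk (by positivity)
    (pow_le_pow_left₀ (by positivity) hhit d)
    (twenty_le_inv_pow_mul (by omega) hL10 (by linarith) (by linarith)) hd

lemma measureReal_exIn_pathGraph_lt_le_of_sparse (hn : 100 ≤ n) (hN : n ≤ N)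
    (hN' : (N : ℝ) ≤ n * Real.exp (6 * n)) {ω : ℝ} (hω : 6 ≤ ω)
    (hL : Real.log ((N : ℝ) / n) = ω * (n * p)) (hp : (N : ℝ)⁻¹ ≤ p) :
    (binomialRandom (Fin N) p).real
      {G | (G.exIn (pathGraph (n + 1)) : ℝ) < 1 / 75 * (ω / Real.log ω) * ((p : ℝ) * n * N)} ≤
      1000 / n := by
  rcases lt_or_ge (10 * Real.log ω) (Real.log ((N : ℝ) / n)) with h | h
  · calc _ ≤ Real.exp (-n) := measureReal_exIn_pathGraph_lt_le_of_log_lt hn hN' hω hL h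
      _ ≤ 1 / n := exp_neg_le_inv (by omega)
      _ ≤ 1000 / n := by gcongr; norm_num
  · refine (measureReal_mono fun G hG ↦ ?_).trans
      (measureReal_exIn_pathGraph_lt_le_of_inv_le hn hN hp)
    rw [Set.mem_ofPred_eq] at hG ⊢
    refine hG.trans_le ?_
    calc 1 / 75 * (ω / Real.log ω) * (p * n * N)
        = 1 / 75 * (Real.log (N / n) / Real.log ω) * N := by rw [hL]; ring
      _ ≤ 1 / 75 * 10 * N := by
          gcongr
          exact (div_le_iff₀ (Real.log_pos (by linarith))).2 h
      _ = 10 / 75 * N := by ring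

lemma one_sub_le_probExPath {k : ℕ} {a b ε δ : ℝ}
    (ha : (binomialRandom (Fin N) p).real {G | (G.exIn (pathGraph k) : ℝ) < a} ≤ ε)
    (hb : (binomialRandom (Fin N) p).real {G | b < (G.exIn (pathGraph k) : ℝ)} ≤ δ) :
    1 - (ε + δ) ≤ probExPath N p k a b := by
  have hcompl : {G : SimpleGraph (Fin N) | a ≤ (G.exIn (pathGraph k) : ℝ) ∧
      (G.exIn (pathGraph k) : ℝ) ≤ b} =
      ({G | (G.exIn (pathGraph k) : ℝ) < a} ∪ {G | b < (G.exIn (pathGraph k) : ℝ)})ᶜ := by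
    ext G
    simp only [Set.mem_ofPred_eq, Set.mem_compl_iff, Set.mem_union, not_or, not_lt]
  rw [probExPath, hcompl, probReal_compl_eq_one_sub MeasurableSet.of_discrete]
  gcongr
  exact (measureReal_union_le _ _).trans (add_le_add ha hb)

lemma tendsto_probExPath {N : ℕ → ℕ} {p : ℕ → I} {a b : ℕ → ℝ}
    (ha : ∀ᶠ n : ℕ in atTop, (binomialRandom (Fin (N n)) (p n)).real
      {G | (G.exIn (pathGraph (n + 1)) : ℝ) < a n} ≤ 1000 / n)
    (hb : ∀ᶠ n : ℕ in atTop, (binomialRandom (Fin (N n)) (p n)).real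
      {G | b n < (G.exIn (pathGraph (n + 1)) : ℝ)} ≤ Real.exp (-n)) :
    Tendsto (fun n : ℕ ↦ probExPath (N n) (p n) (n + 1) (a n) (b n)) atTop (𝓝 1) := by
  have hlim : Tendsto (fun n : ℕ ↦ 1 - (1000 / (n : ℝ) + Real.exp (-n))) atTop (𝓝 1) := by
    have hexp : Tendsto (fun n : ℕ ↦ Real.exp (-(n : ℝ))) atTop (𝓝 0) :=
      Real.tendsto_exp_neg_atTop_nhds_zero.comp tendsto_natCast_atTop_atTop
    simpa using ((tendsto_const_div_atTop_nhds_zero_nat (1000 : ℝ)).add hexp).const_sub 1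
  refine tendsto_of_tendsto_of_tendsto_of_le_of_le' hlim tendsto_const_nhds ?_
    (.of_forall fun n ↦ measureReal_le_one)
  filter_upwards [ha, hb] with n ha hb using one_sub_le_probExPath ha hb

end Estimates

lemma six_le_and_log_eq {n N : ℕ} {p : ℝ} (hn : 0 < n) (hN : 0 < N) (hp : (N : ℝ)⁻¹ ≤ p)
    (hpL : p ≤ Real.log ((N : ℝ) / n) / (6 * n)) :
    6 ≤ Real.log ((N : ℝ) / n) / (n * p) ∧
      Real.log ((N : ℝ) / n) = Real.log ((N : ℝ) / n) / (n * p) * (n * p) := by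
  have hp0 : 0 < p := hp.trans_lt' (by positivity)
  rw [le_div_iff₀ (by positivity)] at hpL ⊢
  exact ⟨by linarith, (div_mul_cancel₀ _ (by positivity)).symm⟩

end PathTuran

theorem theorem1p4_general (N : ℕ → ℕ) (hN : ∀ᶠ n : ℕ in atTop, 3 * (n : ℝ) ≤ N n) :
    (∀ p : ℕ → unitInterval,
      (∀ᶠ n : ℕ in atTop, Real.log ((N n : ℝ) / n) / (6 * n) ≤ (p n : ℝ)) →
      Tendsto
        (fun n : ℕ ↦ SimpleGraph.probExPath (N n) (p n) (n + 1)
          (1 / 4 * ((p n : ℝ) * n * N n))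
          (18 * ((p n : ℝ) * n * N n)))
        atTop (𝓝 1)) ∧
    ((∀ᶠ n : ℕ in atTop, (N n : ℝ) ≤ n * Real.exp (6 * n)) →
      ∀ (p : ℕ → unitInterval) (ω : ℕ → ℝ),
      (∀ n : ℕ, ω n = Real.log ((N n : ℝ) / n) / (n * (p n : ℝ))) →
      (∀ᶠ n : ℕ in atTop, (N n : ℝ)⁻¹ ≤ (p n : ℝ) ∧
        (p n : ℝ) ≤ Real.log ((N n : ℝ) / n) / (6 * n)) →
      Tendsto
        (fun n : ℕ ↦ SimpleGraph.probExPath (N n) (p n) (n + 1)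
          (1 / 75 * (ω n / Real.log (ω n)) * ((p n : ℝ) * n * N n))
          (8 * (ω n / Real.log (ω n)) * ((p n : ℝ) * n * N n)))
        atTop (𝓝 1)) := by
  have hlarge : ∀ᶠ n : ℕ in atTop, 100 ≤ n ∧ n ≤ N n := by
    filter_upwards [hN, eventually_ge_atTop 100] with n hN hn
    exact ⟨hn, by exact_mod_cast (by linarith : (n : ℝ) ≤ N n)⟩
  refine ⟨fun p hp ↦ PathTuran.tendsto_probExPath ?_ ?_,
    fun hN' p ω hω hp ↦ PathTuran.tendsto_probExPath ?_ ?_⟩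
  · filter_upwards [hN, hp, hlarge] with n hN hp ⟨hn, _⟩
    exact PathTuran.measureReal_exIn_pathGraph_lt_le_of_dense hn hN hp
  · filter_upwards [hN, hp, hlarge] with n hN hp ⟨hn, _⟩
    exact PathTuran.measureReal_lt_exIn_pathGraph_le_of_dense (by omega) hN hp
  · filter_upwards [hN', hp, hlarge] with n hN' ⟨hp, hpL⟩ ⟨hn, hnN⟩
    obtain ⟨hω6, hL⟩ := PathTuran.six_le_and_log_eq (by omega) (by omega) hp hpL
    rw [hω]
    exact PathTuran.measureReal_exIn_pathGraph_lt_le_of_sparse hn hnN hN' hω6 hL hp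
  · filter_upwards [hN, hp, hlarge] with n hN ⟨hp, hpL⟩ ⟨hn, hnN⟩
    obtain ⟨hω6, hL⟩ := PathTuran.six_le_and_log_eq (by omega) (by omega) hp hpL
    rw [hω]
    exact PathTuran.measureReal_lt_exIn_pathGraph_le_of_sparse (by omega) hN (by linarith) hL

theorem theorem1p4 (N : ℕ → ℕ)
    (hN : ∀ᶠ n : ℕ in atTop, 3 * (n : ℝ) ≤ N n ∧ (N n : ℝ) ≤ n * Real.exp (2 * n)) :
    (∀ p : ℕ → unitInterval,
      (∀ᶠ n : ℕ in atTop, Real.log ((N n : ℝ) / n) / (6 * n) ≤ (p n : ℝ)) →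
      Tendsto
        (fun n : ℕ ↦ SimpleGraph.probExPath (N n) (p n) (n + 1)
          (1 / 4 * ((p n : ℝ) * n * N n))
          (18 * ((p n : ℝ) * n * N n)))
        atTop (𝓝 1)) ∧
    (∀ (p : ℕ → unitInterval) (ω : ℕ → ℝ),
      (∀ n : ℕ, ω n = Real.log ((N n : ℝ) / n) / (n * (p n : ℝ))) →
      (∀ᶠ n : ℕ in atTop, (N n : ℝ)⁻¹ ≤ (p n : ℝ) ∧
        (p n : ℝ) ≤ Real.log ((N n : ℝ) / n) / (6 * n)) →
      Tendsto
        (fun n : ℕ ↦ SimpleGraph.probExPath (N n) (p n) (n + 1)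
          (1 / 75 * (ω n / Real.log (ω n)) * ((p n : ℝ) * n * N n))
          (8 * (ω n / Real.log (ω n)) * ((p n : ℝ) * n * N n)))
        atTop (𝓝 1)) := by
  obtain ⟨hdense, hsparse⟩ := theorem1p4_general N (hN.mono fun _ h ↦ h.1)
  exact ⟨hdense, hsparse <| hN.mono fun n h ↦ h.2.trans (by gcongr; norm_num)⟩
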